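/- **Conventions.** All graphs are finite and simple. For a graph $F$, $V(F)$ and $E(F)$ are its vertex and edge sets, and $V'(F)\subseteq V(F)$ is the set of vertices incident to at least one edge of $F$. For $S\subseteq[n]$, $I_S$ is the $n\times n$ diagonal matrix with $(I_S)_{ii}=1$ for $i\in S$ and $0$ otherwise, and $\preceq$ is the Loewner order on symmetric matrices. A *near-forest* is a graph in which every connected component has at most one cycle (i.e. satisfies $|E|-|V|+1\le 1$). For reals $\Delta$ and $D$, a graph $H$ is *$(\Delta,D)$-pseudorandom* with respect to $S\subseteq V(H)$ if for all $u\in V(H)$: $|\{v\in V(H):\mathrm{dist}_H(u,v)\le r\}|\le D^{r-1}\Delta$ for all integers $r\ge1$, and $|\{v\in S:\mathrm{dist}_H(u,v)\le r\}|\le D^r$ for all integers $r\ge0$. If $B,H$ are subgraphs of a graph $G$ on $[n]$, put $\partial H=V'(B)\cap V'(H)$; $(B,H)$ is a *$(\Delta,D)$-decomposition* of $G$ if $E(G)=E(B)\sqcup E(H)$ and $H$ is a near-forest that is $(\Delta,D)$-pseudorandom with respect to $\partial H$. Write $I_B=I_{V'(B)}$, $I_{H\setminus\partial H}=I_{V'(H)\setminus\partial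 H}$, and $I_{\mathrm{iso}}=I_{[n]\setminus V'(G)}$, which corresponds to the isolated vertices of $G$. For symmetric $J\in\mathbb R^{n\times n}$ and $h\in\mathbb R^n$, $\mu_{J,h}$ is the probability distribution on $\{\pm1\}^n$ with $\mu_{J,h}(\sigma)\propto\exp\left(\tfrac12\sigma^\top J\sigma+\langle h,\sigma\rangle\right)$, and $\mathrm{Cov}(\mu)=\mathbb E_\mu[\sigma\sigma^\top]-\mathbb E_\mu[\sigma]\,\mathbb E_\mu[\sigma]^\top$. **Theorem.** Let $\eta,K\in(0,1)$, $\gamma\in[0,1)$ and $\delta>0$. There is a constant $C>0$, depending only on $\eta,K,\gamma,\delta$ (in particular not on $\Delta$), such that the following holds for all $n$, all reals $\Delta$ and $D>0$, every graph $G$ on $[n]$, every $(\Delta,D)$-decomposition $(B,H)$ of $G$, and all symmetric $J_B,J_H\in\mathbb R^{n\times n}$ whose off-diagonal entries are supported on $E(B)$ and $E(H)$, respectively. Suppose that $\eta I_B\preceq J_B\preceq K I_B$, that all off-diagonal entries of $J_H$ lie in $[-\gamma/\sqrt D,\gamma/\sqrt D]$, and that $$K\cdot\frac{e^{2\gamma/\sqrt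 D}}{(1-\gamma)^2}\le 1-\delta .$$ Then for all $t\in[0,1]$ and all $h\in\mathbb R^n$, $$\mathrm{Cov}\left(\mu_{(1-t)J_B+J_H,\,h}\right)\preceq C\left(I_B+\Delta\, I_{H\setminus\partial H}+I_{\mathrm{iso}}\right).$$ In particular, if $G$ has no isolated vertices, then the right-hand side is $C(I_B+\Delta I_{H\setminus\partial H})$. -/

import Mathlib

noncomputable section

namespace NearForestIsing

/-! ### Graphs, near-forests and decompositions -/

/-- The tree-excess `|E| - |V| + 1` of a finite (connected) graph. -/
def treeExcess {W : Type*} (F : SimpleGraph W) : ℤ :=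
  (F.edgeSet.ncard : ℤ) - (Nat.card W : ℤ) + 1

/-- A near-forest: every connected component has tree-excess at most `1`, i.e. contains at most
one cycle. -/
def IsNearForest {W : Type*} (F : SimpleGraph W) : Prop :=
  ∀ c : F.ConnectedComponent, treeExcess c.toSimpleGraph ≤ 1

/-- `F` is `(Δ, D)`-pseudorandom with respect to the vertex set `S`. Distances are taken in
`ℕ∞`, so that vertices in different components are at distance `⊤`. -/
structure IsPseudorandom {W : Type*} (F : SimpleGraph W) (S : Set W) (Δ D : ℝ) : Prop where
  ball_le : ∀ r : ℕ, 1 ≤ r → ∀ u : W, ({v | F.edist u v ≤ r}.ncard : ℝ) ≤ D ^ (r - 1) * Δ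
  ball_inter_le : ∀ (r : ℕ) (u : W), ({v ∈ S | F.edist u v ≤ r}.ncard : ℝ) ≤ D ^ r

variable {n : ℕ}

/-- The boundary `∂H = V'(B) ∩ V'(H)`, where `V'(F)` is the set of vertices of `F` that are
incident to an edge of `F` (Mathlib's `SimpleGraph.Subgraph.support`). -/
def boundary {G : SimpleGraph (Fin n)} (B H : G.Subgraph) : Set (Fin n) :=
  B.support ∩ H.support

/-- `(B, H)` is a `(Δ, D)`-decomposition of `G` into a bulk `B` and a near-forest `H`. The
near-forest is regarded as a graph on its own vertex set `V(H)`. -/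
structure IsDecomposition (G : SimpleGraph (Fin n)) (B H : G.Subgraph) (Δ D : ℝ) : Prop where
  edges_union : G.edgeSet = B.edgeSet ∪ H.edgeSet
  edges_disjoint : Disjoint B.edgeSet H.edgeSet
  near_forest : IsNearForest H.coe
  pseudorandom : IsPseudorandom H.coe ((fun v : H.verts => (v : Fin n)) ⁻¹' boundary B H) Δ D

/-! ### Ising models -/

/-- Spin configurations `σ ∈ {±1}ⁿ`. -/
abbrev Config (n : ℕ) : Type := Fin n → ℤˣ

/-- A spin configuration as a vector of `ℝⁿ`. -/
def spin (σ : Config n) : Fin n → ℝ := fun i => ((σ i : ℤ) : ℝ)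

/-- The unnormalized weight `exp(½ σᵀ J σ + ⟨h, σ⟩)`. -/
def isingWeight (J : Matrix (Fin n) (Fin n) ℝ) (h : Fin n → ℝ) (σ : Config n) : ℝ :=
  Real.exp ((1 / 2) * (spin σ ⬝ᵥ J.mulVec (spin σ)) + h ⬝ᵥ spin σ)

/-- The partition function `Z_{J,h}`. -/
def partitionFunction (J : Matrix (Fin n) (Fin n) ℝ) (h : Fin n → ℝ) : ℝ :=
  ∑ σ : Config n, isingWeight J h σ

/-- The probability mass function of the Ising model `μ_{J,h}` on `{±1}ⁿ`. -/
def ising (J : Matrix (Fin n) (Fin n) ℝ) (h : Fin n → ℝ) (σ : Config n) : ℝ :=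
  isingWeight J h σ / partitionFunction J h

/-- The covariance matrix `E[σ σᵀ] - E[σ] E[σ]ᵀ` of a random spin configuration with
probability mass function `μ`. -/
def cov (μ : Config n → ℝ) : Matrix (Fin n) (Fin n) ℝ :=
  Matrix.of fun i j =>
    (∑ σ, μ σ * (spin σ i * spin σ j)) - (∑ σ, μ σ * spin σ i) * (∑ σ, μ σ * spin σ j)

/-- The matrix `I_S`: the identity matrix with all rows and columns outside `S` set to zero. -/
def idOn (S : Set (Fin n)) : Matrix (Fin n) (Fin n) ℝ :=
  Matrix.diagonal (S.indicator fun _ => 1)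

/-- The Loewner order: `A ⪯ A'` if `A' - A` is symmetric positive semidefinite. -/
def Loewner (A A' : Matrix (Fin n) (Fin n) ℝ) : Prop := (A' - A).PosSemidef

/-- The off-diagonal entries of `J` are supported on the edges of `F`. -/
def SupportedOn {G : SimpleGraph (Fin n)} (J : Matrix (Fin n) (Fin n) ℝ) (F : G.Subgraph) : Prop :=
  ∀ i j, i ≠ j → ¬ F.Adj i j → J i j = 0

end NearForestIsing

end

/-! Write A = e^{2γ/√D}/(1-γ)². The matrix (1-t)J_B is positive semidefinite, hence a sum of
rank-one terms b_k b_kᵀ. By the Hubbard–Stratonovich identity, adding a term w wᵀ to the interaction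
turns the measure into a mixture, over a real variable g, of the original model with fields h + g w.
`wCov_gaussian_mixture_le` is a one-dimensional Brascamp–Lieb inequality for such mixtures: if Var⟨v
+ s w, σ⟩ ≤ R + s² for all fields and all s, then after adding w wᵀ the variance of ⟨v, σ⟩ is at
most R. Iterating over k (`linVar_add_sum_vecMulVec_le`), it suffices to bound the model J_H alone,
uniformly in the field, as long as the bound at v + Σ c_k b_k exceeds R by at most Σ c_k².

For J_H, covariances across a cut edge factor with ratio at most the absolute coupling, whatever the
field (`exists_spinCov_eq_mul`). On a rooted forest they therefore decay like (γ/√D)^{a+b} through a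
common ancestor a and b generations up, and Cauchy–Schwarz against a growth c Dᵃ of the set of a-th
descendants gives variance at most c(1-γ)⁻²|x|². The edge closing a cycle in a component is deleted
at the cost of a factor e^{2γ/√D}. Pseudorandomness supplies c = Δ on V'(H)∖∂H and c = 1 off it.

Finally J_B ⪯ K I_B gives |Σ c_k b_k|² ≤ K Σ c_k², and these vectors vanish on V'(H)∖∂H. The shift
thus costs essentially KA ≤ 1-δ and never meets Δ, which is why C does not depend on Δ. -/

open MeasureTheory

namespace NearForestIsing

/-! ### Means and covariances for weights on a finite type -/

section Weighted

variable {Ω : Type*} [Fintype Ω]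

/-- The mean of `f` under the probability distribution proportional to the weight `p`. -/
noncomputable def wMean (p f : Ω → ℝ) : ℝ := (∑ σ, p σ * f σ) / ∑ σ, p σ

/-- The covariance of `f` and `g` under the distribution proportional to the weight `p`. -/
noncomputable def wCov (p f g : Ω → ℝ) : ℝ :=
  wMean p (fun σ => f σ * g σ) - wMean p f * wMean p g

lemma wMean_add (p f g : Ω → ℝ) :
    wMean p (fun σ => f σ + g σ) = wMean p f + wMean p g := by
  simp only [wMean, mul_add, Finset.sum_add_distrib, add_div]

lemma wMean_const_mul (p f : Ω → ℝ) (c : ℝ) :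
    wMean p (fun σ => c * f σ) = c * wMean p f := by
  simp only [wMean, mul_left_comm _ c, ← Finset.mul_sum, mul_div_assoc]

lemma wMean_sum {ι : Type*} (s : Finset ι) (p : Ω → ℝ) (f : ι → Ω → ℝ) :
    wMean p (fun σ => ∑ i ∈ s, f i σ) = ∑ i ∈ s, wMean p (f i) := by
  simp only [wMean, Finset.mul_sum]
  rw [Finset.sum_comm, Finset.sum_div]

lemma wMean_const [Nonempty Ω] {p : Ω → ℝ} (hp : ∀ σ, 0 < p σ) (c : ℝ) :
    wMean p (fun _ => c) = c := by
  have : 0 < ∑ σ, p σ := Finset.sum_pos (fun σ _ => hp σ) Finset.univ_nonempty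
  rw [wMean, ← Finset.sum_mul, mul_div_cancel_left₀ _ this.ne']

lemma wMean_mono {p f g : Ω → ℝ} (hp : ∀ σ, 0 < p σ) (h : ∀ σ, f σ ≤ g σ) :
    wMean p f ≤ wMean p g := by
  unfold wMean
  gcongr with σ
  · exact Finset.sum_nonneg fun σ _ => (hp σ).le
  · exact (hp σ).le
  · exact h σ

lemma abs_wMean_le [Nonempty Ω] {p f : Ω → ℝ} (hp : ∀ σ, 0 < p σ) {M : ℝ}
    (h : ∀ σ, |f σ| ≤ M) : |wMean p f| ≤ M := by
  rw [abs_le]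
  constructor
  · calc -M = wMean p (fun _ => -M) := (wMean_const hp _).symm
      _ ≤ _ := wMean_mono hp fun σ => (abs_le.1 (h σ)).1
  · calc wMean p f ≤ wMean p (fun _ => M) := wMean_mono hp fun σ => (abs_le.1 (h σ)).2
      _ = M := wMean_const hp _

lemma wCov_comm (p f g : Ω → ℝ) : wCov p f g = wCov p g f := by
  simp only [wCov, mul_comm]

lemma wCov_add_left (p f g k : Ω → ℝ) :
    wCov p (fun σ => f σ + g σ) k = wCov p f k + wCov p g k := by
  simp only [wCov, add_mul, wMean_add]; ring

lemma wCov_add_right (p f g k : Ω → ℝ) :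
    wCov p k (fun σ => f σ + g σ) = wCov p k f + wCov p k g := by
  rw [wCov_comm, wCov_add_left, wCov_comm p f, wCov_comm p g]

lemma wCov_const_mul_left (p f k : Ω → ℝ) (c : ℝ) :
    wCov p (fun σ => c * f σ) k = c * wCov p f k := by
  simp only [wCov, mul_assoc, wMean_const_mul]; ring

lemma wCov_const_mul_right (p f k : Ω → ℝ) (c : ℝ) :
    wCov p k (fun σ => c * f σ) = c * wCov p k f := by
  rw [wCov_comm, wCov_const_mul_left, wCov_comm]

lemma wCov_sum_left {ι : Type*} (s : Finset ι) (p : Ω → ℝ) (f : ι → Ω → ℝ) (k : Ω → ℝ) :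
    wCov p (fun σ => ∑ i ∈ s, f i σ) k = ∑ i ∈ s, wCov p (f i) k := by
  simp only [wCov, Finset.sum_mul, wMean_sum, Finset.sum_sub_distrib]

lemma wCov_sum_right {ι : Type*} (s : Finset ι) (p : Ω → ℝ) (f : ι → Ω → ℝ) (k : Ω → ℝ) :
    wCov p k (fun σ => ∑ i ∈ s, f i σ) = ∑ i ∈ s, wCov p k (f i) := by
  rw [wCov_comm, wCov_sum_left]
  simp only [wCov_comm p k]

lemma wMean_sub_sq [Nonempty Ω] {p : Ω → ℝ} (hp : ∀ σ, 0 < p σ) (f : Ω → ℝ) (c : ℝ) :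
    wMean p (fun σ => (f σ - c) ^ 2) = wCov p f f + (wMean p f - c) ^ 2 := by
  have : (fun σ => (f σ - c) ^ 2) =
      fun σ => f σ * f σ + ((-2 * c) * f σ + c ^ 2) := by ext; ring
  rw [this, wMean_add p (fun σ => f σ * f σ), wMean_add p (fun σ => (-2 * c) * f σ),
    wMean_const_mul, wMean_const hp, wCov]
  ring

lemma wCov_self_le [Nonempty Ω] {p : Ω → ℝ} (hp : ∀ σ, 0 < p σ) (f : Ω → ℝ) (c : ℝ) :
    wCov p f f ≤ wMean p (fun σ => (f σ - c) ^ 2) := by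
  rw [wMean_sub_sq hp]
  exact le_add_of_nonneg_right (sq_nonneg _)

lemma wCov_self_eq [Nonempty Ω] {p : Ω → ℝ} (hp : ∀ σ, 0 < p σ) (f : Ω → ℝ) :
    wCov p f f = wMean p (fun σ => (f σ - wMean p f) ^ 2) := by
  rw [wMean_sub_sq hp]; simp

lemma wMean_nonneg {p f : Ω → ℝ} (hp : ∀ σ, 0 < p σ) (hf : ∀ σ, 0 ≤ f σ) : 0 ≤ wMean p f :=
  div_nonneg (Finset.sum_nonneg fun σ _ => mul_nonneg (hp σ).le (hf σ))
    (Finset.sum_nonneg fun σ _ => (hp σ).le)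

lemma wCov_self_nonneg [Nonempty Ω] {p : Ω → ℝ} (hp : ∀ σ, 0 < p σ) (f : Ω → ℝ) :
    0 ≤ wCov p f f := by
  rw [wCov_self_eq hp]
  exact wMean_nonneg hp fun σ => sq_nonneg _

/-- Variances under comparable weights are comparable. -/
lemma wCov_self_le_of_weight_le [Nonempty Ω] {p q : Ω → ℝ} (hp : ∀ σ, 0 < p σ)
    (hq : ∀ σ, 0 < q σ) {r : ℝ} (h₁ : ∀ σ, p σ ≤ Real.exp r * q σ)
    (h₂ : ∀ σ, Real.exp (-r) * q σ ≤ p σ) (f : Ω → ℝ) :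
    wCov p f f ≤ Real.exp (2 * r) * wCov q f f := by
  -- Any centre bounds the `p`-variance from above, and this one attains the `q`-variance. One
  -- factor e^r comes from the numerator, one from the normalization.
  refine (wCov_self_le hp f (wMean q f)).trans ?_
  rw [wCov_self_eq hq]
  have hZ : 0 < ∑ σ, q σ := Finset.sum_pos (fun σ _ => hq σ) Finset.univ_nonempty
  unfold wMean
  set m := (∑ σ, q σ * f σ) / ∑ σ, q σ
  have hnum : ∑ σ, p σ * (f σ - m) ^ 2 ≤ Real.exp r * ∑ σ, q σ * (f σ - m) ^ 2 := by
    rw [Finset.mul_sum]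
    refine Finset.sum_le_sum fun σ _ => ?_
    rw [← mul_assoc]
    exact mul_le_mul_of_nonneg_right (h₁ σ) (sq_nonneg _)
  have hden : Real.exp (-r) * ∑ σ, q σ ≤ ∑ σ, p σ := by
    rw [Finset.mul_sum]
    exact Finset.sum_le_sum fun σ _ => h₂ σ
  have hN : 0 ≤ ∑ σ, q σ * (f σ - m) ^ 2 :=
    Finset.sum_nonneg fun σ _ => mul_nonneg (hq σ).le (sq_nonneg _)
  calc _ ≤ (Real.exp r * ∑ σ, q σ * (f σ - m) ^ 2) / (Real.exp (-r) * ∑ σ, q σ) := by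
        gcongr
    _ = _ := by
        rw [Real.exp_neg, two_mul, Real.exp_add]
        field_simp

lemma wCov_self_add_le [Nonempty Ω] {p : Ω → ℝ} (hp : ∀ σ, 0 < p σ) (f g : Ω → ℝ) {ε : ℝ}
    (hε : 0 < ε) :
    wCov p (fun σ => f σ + g σ) (fun σ => f σ + g σ) ≤
      (1 + ε) * wCov p f f + (1 + 1 / ε) * wCov p g g := by
  -- The claim is that Var(εf - g)/ε is nonnegative.
  have h := wCov_self_nonneg hp (fun σ => ε * f σ + (-1) * g σ)
  simp only [wCov_add_left, wCov_add_right, wCov_const_mul_left, wCov_const_mul_right] at h ⊢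
  rw [wCov_comm p g f] at h ⊢
  have h2 : 0 ≤ (1 / ε) * (ε * (ε * wCov p f f) + -1 * (ε * wCov p f g) +
    (ε * (-1 * wCov p f g) + -1 * (-1 * wCov p g g))) := by
    refine mul_nonneg (by positivity) ?_
    linarith
  have h3 : (1 / ε) * (ε * (ε * wCov p f f) + -1 * (ε * wCov p f g) +
    (ε * (-1 * wCov p f g) + -1 * (-1 * wCov p g g))) =
      ε * wCov p f f - 2 * wCov p f g + 1 / ε * wCov p g g := by
    field_simp; ring
  linarith

end Weighted

/-! ### Gaussian mixtures of exponential tilts -/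

section Tilt

variable {Ω : Type*}

/-- The exponential tilt of the weight `p` in direction `a`. -/
noncomputable def tilt (p a : Ω → ℝ) (g : ℝ) (σ : Ω) : ℝ := p σ * Real.exp (g * a σ)

lemma tilt_pos {p : Ω → ℝ} (hp : ∀ σ, 0 < p σ) (a : Ω → ℝ) (g : ℝ) (σ : Ω) :
    0 < tilt p a g σ := mul_pos (hp σ) (Real.exp_pos _)

lemma hasDerivAt_tilt (p a : Ω → ℝ) (σ : Ω) (g : ℝ) :
    HasDerivAt (fun g => tilt p a g σ) (tilt p a g σ * a σ) g := by
  have h := (((hasDerivAt_id g).mul_const (a σ)).exp).const_mul (p σ)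
  simpa [tilt, mul_assoc] using h

variable [Fintype Ω]

lemma hasDerivAt_sum_tilt (p a f : Ω → ℝ) (g : ℝ) :
    HasDerivAt (fun g => ∑ σ, tilt p a g σ * f σ) (∑ σ, tilt p a g σ * (a σ * f σ)) g := by
  have h : ∀ σ ∈ Finset.univ, HasDerivAt (fun g => tilt p a g σ * f σ)
      (tilt p a g σ * (a σ * f σ)) g := fun σ _ => by
    simpa [mul_assoc] using (hasDerivAt_tilt p a σ g).mul_const (f σ)
  simpa using HasDerivAt.fun_sum h

lemma hasDerivAt_wMean_tilt [Nonempty Ω] {p : Ω → ℝ} (hp : ∀ σ, 0 < p σ) (a f : Ω → ℝ) (g : ℝ) :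
    HasDerivAt (fun g => wMean (tilt p a g) f) (wCov (tilt p a g) a f) g := by
  have hZ : 0 < ∑ σ, tilt p a g σ :=
    Finset.sum_pos (fun σ _ => tilt_pos hp a g σ) Finset.univ_nonempty
  have h1 := hasDerivAt_sum_tilt p a f g
  have h2 := hasDerivAt_sum_tilt p a (fun _ => 1) g
  simp only [mul_one] at h2
  refine (h1.div h2 hZ.ne').congr_deriv ?_
  unfold wCov wMean
  field_simp

lemma continuous_wMean_tilt [Nonempty Ω] {p : Ω → ℝ} (hp : ∀ σ, 0 < p σ) (a f : Ω → ℝ) :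
    Continuous fun g => wMean (tilt p a g) f :=
  continuous_iff_continuousAt.2 fun g => (hasDerivAt_wMean_tilt hp a f g).continuousAt

lemma continuous_wCov_tilt [Nonempty Ω] {p : Ω → ℝ} (hp : ∀ σ, 0 < p σ) (a f k : Ω → ℝ) :
    Continuous fun g => wCov (tilt p a g) f k :=
  (continuous_wMean_tilt hp a _).sub
    ((continuous_wMean_tilt hp a _).mul (continuous_wMean_tilt hp a _))

lemma integral_gaussian_mul_exp (a : ℝ) :
    ∫ g : ℝ, Real.exp (-g ^ 2 / 2) * Real.exp (g * a) =
      √(2 * Real.pi) * Real.exp (a ^ 2 / 2) := by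
  have h : (fun g : ℝ => Real.exp (-g ^ 2 / 2) * Real.exp (g * a)) =
      fun g => Real.exp (a ^ 2 / 2) * Real.exp (-(1 / 2) * (g - a) ^ 2) := by
    ext g
    rw [← Real.exp_add, ← Real.exp_add]; congr 1; ring
  rw [h, integral_const_mul,
    integral_sub_right_eq_self (fun g : ℝ => Real.exp (-(1 / 2) * g ^ 2)) a,
    integral_gaussian, mul_comm]
  congr 2; ring

lemma integrable_gaussian_mul_exp_mul (a : ℝ) {f : ℝ → ℝ} (hf : Continuous f) {C : ℝ}
    (hC : ∀ g, |f g| ≤ C * (1 + g ^ 2)) :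
    Integrable fun g : ℝ => Real.exp (-g ^ 2 / 2) * Real.exp (g * a) * f g := by
  have hC0 : 0 ≤ C := by simpa using (abs_nonneg _).trans (hC 0)
  refine ((integrable_exp_neg_mul_sq (b := 1 / 8) (by norm_num)).const_mul
    (8 * C * Real.exp (a ^ 2))).mono' (by fun_prop) (Filter.Eventually.of_forall fun g => ?_)
  rw [Real.norm_eq_abs, abs_mul, ← Real.exp_add, abs_of_pos (Real.exp_pos _)]
  -- Half of the Gaussian exponent absorbs the tilt; half of the remainder absorbs the quadratic
  -- growth of `f`, leaving e^{-g²/8}.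
  have h1 : Real.exp (-g ^ 2 / 2 + g * a) ≤ Real.exp (a ^ 2) * Real.exp (-g ^ 2 / 4) := by
    rw [← Real.exp_add, Real.exp_le_exp]
    nlinarith [sq_nonneg (g / 2 - a)]
  have h2 : 1 + g ^ 2 ≤ 8 * Real.exp (g ^ 2 / 8) := by
    have := Real.add_one_le_exp (g ^ 2 / 8)
    nlinarith
  calc _ ≤ (Real.exp (a ^ 2) * Real.exp (-g ^ 2 / 4)) * (C * (8 * Real.exp (g ^ 2 / 8))) := by
        refine mul_le_mul h1 ((hC g).trans (by gcongr)) (abs_nonneg _) (by positivity)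
    _ = 8 * C * Real.exp (a ^ 2) * (Real.exp (-g ^ 2 / 4) * Real.exp (g ^ 2 / 8)) := by ring
    _ = _ := by rw [← Real.exp_add]; congr 2; ring

/-- The density (up to normalization) of the Gaussian mixture. -/
noncomputable def mixDensity (p a : Ω → ℝ) (g : ℝ) : ℝ :=
  Real.exp (-g ^ 2 / 2) * ∑ σ, tilt p a g σ

lemma integrable_mixDensity_mul (p a : Ω → ℝ) {f : ℝ → ℝ} (hf : Continuous f) {C : ℝ}
    (hC : ∀ g, |f g| ≤ C * (1 + g ^ 2)) :
    Integrable fun g => mixDensity p a g * f g := by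
  have h : (fun g => mixDensity p a g * f g) = fun g =>
      ∑ σ, p σ * (Real.exp (-g ^ 2 / 2) * Real.exp (g * a σ) * f g) := by
    ext g
    simp only [mixDensity, tilt, Finset.mul_sum, Finset.sum_mul]
    exact Finset.sum_congr rfl fun σ _ => by ring
  rw [h]
  exact integrable_finsetSum _ fun σ _ => (integrable_gaussian_mul_exp_mul _ hf hC).const_mul _

/-- Hubbard–Stratonovich: the partition function inside `mixDensity` cancels the normalization of
the tilted mean, and each e^{ga} then integrates to √(2π) e^{a²/2}. -/
lemma integral_mixDensity_mul_wMean [Nonempty Ω] {p : Ω → ℝ} (hp : ∀ σ, 0 < p σ)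
    (a f : Ω → ℝ) :
    ∫ g, mixDensity p a g * wMean (tilt p a g) f =
      √(2 * Real.pi) * ∑ σ, p σ * Real.exp (a σ ^ 2 / 2) * f σ := by
  have h : (fun g => mixDensity p a g * wMean (tilt p a g) f) = fun g =>
      ∑ σ, (p σ * f σ) * (Real.exp (-g ^ 2 / 2) * Real.exp (g * a σ)) := by
    ext g
    have hZ : 0 < ∑ σ, tilt p a g σ :=
      Finset.sum_pos (fun σ _ => tilt_pos hp a g σ) Finset.univ_nonempty
    rw [mixDensity, wMean, mul_assoc, mul_div_cancel₀ _ hZ.ne', Finset.mul_sum]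
    refine Finset.sum_congr rfl fun σ _ => ?_
    rw [tilt]; ring
  rw [h, integral_finsetSum]
  · rw [Finset.mul_sum]
    refine Finset.sum_congr rfl fun σ _ => ?_
    rw [integral_const_mul, integral_gaussian_mul_exp]; ring
  · intro σ _
    have := integrable_gaussian_mul_exp_mul (a σ) (f := fun _ => 1) continuous_const (C := 1)
      (fun g => by simp; positivity)
    simp only [mul_one] at this
    exact this.const_mul _

lemma hasDerivAt_mixDensity [Nonempty Ω] {p : Ω → ℝ} (hp : ∀ σ, 0 < p σ) (a : Ω → ℝ) (g : ℝ) :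
    HasDerivAt (mixDensity p a) (-(mixDensity p a g * (g - wMean (tilt p a g) a))) g := by
  have hZ : 0 < ∑ σ, tilt p a g σ :=
    Finset.sum_pos (fun σ _ => tilt_pos hp a g σ) Finset.univ_nonempty
  have h1 := hasDerivAt_sum_tilt p a (fun _ => 1) g
  simp only [mul_one] at h1
  have h2 : HasDerivAt (fun g : ℝ => Real.exp (-g ^ 2 / 2)) (Real.exp (-g ^ 2 / 2) * (-g)) g := by
    have := (((hasDerivAt_pow 2 g).fun_neg).div_const 2).exp
    refine this.congr_deriv ?_
    push_cast
    ring
  refine (h2.mul h1).congr_deriv ?_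
  unfold mixDensity wMean
  field_simp
  ring

/-- A one-dimensional Brascamp–Lieb inequality, for Gaussian mixtures of exponential tilts. -/
theorem wCov_gaussian_mixture_le [Nonempty Ω] {p : Ω → ℝ} (hp : ∀ σ, 0 < p σ) (a b : Ω → ℝ)
    (R : ℝ)
    (h : ∀ g s : ℝ, wCov (tilt p a g) (fun σ => b σ + s * a σ) (fun σ => b σ + s * a σ) ≤
      R + s ^ 2) :
    wCov (fun σ => p σ * Real.exp (a σ ^ 2 / 2)) b b ≤ R := by
  have hP : ∀ σ, 0 < p σ * Real.exp (a σ ^ 2 / 2) := fun σ => mul_pos (hp σ) (Real.exp_pos _)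
  obtain ⟨A, hA⟩ : ∃ A, ∀ σ, |a σ| ≤ A := by
    obtain ⟨A, hA⟩ := (Set.finite_range fun σ => |a σ|).bddAbove
    exact ⟨A, fun σ => hA ⟨σ, rfl⟩⟩
  have hma : ∀ g, |wMean (tilt p a g) a| ≤ A := fun g => abs_wMean_le (tilt_pos hp a g) hA
  have hA0 : 0 ≤ A := (abs_nonneg _).trans (hma 0)
  set U : ℝ → ℝ := fun g => g - wMean (tilt p a g) a with hU
  have hUc : Continuous U := continuous_id.sub (continuous_wMean_tilt hp a a)
  have hUd : ∀ g, HasDerivAt U (1 - wCov (tilt p a g) a a) g := fun g =>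
    (hasDerivAt_id g).sub (hasDerivAt_wMean_tilt hp a a g)
  -- `U` is minus the logarithmic derivative of `mixDensity p a`, so `y` is a critical point of the
  -- density.
  obtain ⟨y, hy⟩ : ∃ y, U y = 0 := by
    have h0 : (0 : ℝ) ∈ Set.Icc (U (-A)) (U A) := by
      constructor
      · have := (abs_le.1 (hma (-A))).1
        simp only [hU]; linarith
      · have := (abs_le.1 (hma A)).2
        simp only [hU]; linarith
    obtain ⟨y, -, hy⟩ := intermediate_value_Icc (by linarith) hUc.continuousOn h0
    exact ⟨y, hy⟩
  set V : ℝ → ℝ := fun g => wCov (tilt p a g) b b with hV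
  have hVc : Continuous V := continuous_wCov_tilt hp a b b
  have hV0 : ∀ g, 0 ≤ V g := fun g => wCov_self_nonneg (tilt_pos hp a g) b
  have hVR : ∀ g, V g ≤ R := fun g => by simpa using h g 0
  set m : ℝ → ℝ := fun g => wMean (tilt p a g) b with hm
  -- The primitive of R - V is chosen so that integrating U Φ by parts against the density returns R
  -- - V.
  set Φ : ℝ → ℝ := fun g => ∫ t in y..g, (R - V t) with hΦ
  have hΦd : ∀ g, HasDerivAt Φ (R - V g) g := fun g =>
    intervalIntegral.integral_hasDerivAt_right
      ((continuous_const.sub hVc).intervalIntegrable _ _)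
      (continuous_const.sub hVc).stronglyMeasurable.stronglyMeasurableAtFilter
      (continuous_const.sub hVc).continuousAt
  have hΦc : Continuous Φ := continuous_iff_continuousAt.2 fun g => (hΦd g).continuousAt
  have hR0 : 0 ≤ R := (hV0 0).trans (hVR 0)
  have hΦb : ∀ g, |Φ g| ≤ R * |g - y| := fun g => by
    rw [← Real.norm_eq_abs]
    refine intervalIntegral.norm_integral_le_of_norm_le_const fun t _ => ?_
    rw [Real.norm_eq_abs, abs_of_nonneg (sub_nonneg.2 (hVR t))]
    linarith [hV0 t]
  -- The derivative is R + s² - Var(b + s a) under the tilt at g, which `h` makes nonnegative.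
  have hmono : ∀ s : ℝ, Monotone fun g => Φ g - 2 * s * m g + s ^ 2 * U g := fun s => by
    have hd : ∀ g, HasDerivAt (fun g => Φ g - 2 * s * m g + s ^ 2 * U g)
        ((R - V g) - 2 * s * wCov (tilt p a g) a b + s ^ 2 * (1 - wCov (tilt p a g) a a)) g :=
      fun g => ((hΦd g).sub ((hasDerivAt_wMean_tilt hp a b g).const_mul (2 * s))).add
        ((hUd g).const_mul (s ^ 2))
    refine monotone_of_deriv_nonneg (fun g => (hd g).differentiableAt) fun g => ?_
    rw [(hd g).deriv]
    have := h g s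
    simp only [wCov_add_left, wCov_add_right, wCov_const_mul_left, wCov_const_mul_right] at this
    rw [wCov_comm _ b a] at this
    simp only [hV]
    nlinarith
  have hΦy : Φ y = 0 := by simp [hΦ]
  -- Since U and Φ vanish at y, monotonicity says that Φ - 2s(m g - m y) + s²U has a constant sign
  -- in s on each side of y. Its discriminant is then nonpositive.
  have key : ∀ g, (m g - m y) ^ 2 ≤ U g * Φ g := fun g => by
    have hdisc : ∀ g, (∀ s : ℝ, 0 ≤ Φ g - 2 * s * (m g - m y) + s ^ 2 * U g) →
        (m g - m y) ^ 2 ≤ U g * Φ g := fun g hs => by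
      have := discrim_le_zero (a := U g) (b := -2 * (m g - m y)) (c := Φ g)
        (fun s => by linarith [hs s])
      unfold discrim at this
      nlinarith
    rcases le_total y g with hg | hg
    · refine hdisc g fun s => ?_
      have := hmono s hg
      simp only [hΦy, hy] at this
      linarith
    · have hs : ∀ s : ℝ, Φ g - 2 * s * (m g - m y) + s ^ 2 * U g ≤ 0 := fun s => by
        have := hmono s hg
        simp only [hΦy, hy] at this
        linarith
      have := discrim_le_zero (a := -U g) (b := 2 * (m g - m y)) (c := -Φ g)
        (fun s => by linarith [hs s])
      unfold discrim at this
      nlinarith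
  have hUb : ∀ g, |U g| ≤ (1 + A) * (1 + |g|) := fun g => by
    calc |U g| ≤ |g| + |wMean (tilt p a g) a| := abs_sub _ _
      _ ≤ |g| + A := by gcongr; exact hma g
      _ ≤ _ := by nlinarith [abs_nonneg g]
  have hΦb' : ∀ g, |Φ g| ≤ R * (1 + |y|) * (1 + |g|) := fun g => by
    refine (hΦb g).trans ?_
    rw [mul_assoc]
    refine mul_le_mul_of_nonneg_left ((abs_sub _ _).trans ?_) hR0
    nlinarith [abs_nonneg g, abs_nonneg y, mul_nonneg (abs_nonneg y) (abs_nonneg g)]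
  have hsq : ∀ g : ℝ, (1 + |g|) ≤ 2 * (1 + g ^ 2) := fun g => by
    nlinarith [sq_abs g, sq_nonneg (|g| - 1)]
  have hsq2 : ∀ g : ℝ, (1 + |g|) * (1 + |g|) ≤ 2 * (1 + g ^ 2) := fun g => by
    nlinarith [sq_abs g, sq_nonneg (|g| - 1)]
  have iUΦ : Integrable fun g => mixDensity p a g * (U g * Φ g) := by
    refine integrable_mixDensity_mul p a (hUc.mul hΦc)
      (C := (1 + A) * (R * (1 + |y|)) * 2) fun g => ?_
    rw [abs_mul]
    calc |U g| * |Φ g| ≤ ((1 + A) * (1 + |g|)) * (R * (1 + |y|) * (1 + |g|)) :=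
          mul_le_mul (hUb g) (hΦb' g) (abs_nonneg _) (by positivity)
      _ = (1 + A) * (R * (1 + |y|)) * ((1 + |g|) * (1 + |g|)) := by ring
      _ ≤ (1 + A) * (R * (1 + |y|)) * (2 * (1 + g ^ 2)) := mul_le_mul_of_nonneg_left (hsq2 g) (by positivity)
      _ = _ := by ring
  have iΦ : Integrable fun g => mixDensity p a g * Φ g := by
    refine integrable_mixDensity_mul p a hΦc (C := R * (1 + |y|) * 2) fun g => ?_
    calc |Φ g| ≤ _ := hΦb' g
      _ ≤ R * (1 + |y|) * (2 * (1 + g ^ 2)) := mul_le_mul_of_nonneg_left (hsq g) (by positivity)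
      _ = _ := by ring
  have ibdd : ∀ f : ℝ → ℝ, Continuous f → (∃ C, ∀ g, |f g| ≤ C) →
      Integrable fun g => mixDensity p a g * f g := fun f hf ⟨C, hC⟩ => by
    refine integrable_mixDensity_mul p a hf (C := C) fun g => (hC g).trans ?_
    have : 0 ≤ C := (abs_nonneg _).trans (hC 0)
    nlinarith [sq_nonneg g]
  have iRV : Integrable fun g => mixDensity p a g * (R - V g) :=
    ibdd _ (continuous_const.sub hVc) ⟨R, fun g => by
      rw [abs_of_nonneg (sub_nonneg.2 (hVR g))]; linarith [hV0 g]⟩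
  have parts : ∫ g, mixDensity p a g * (U g * Φ g) = ∫ g, mixDensity p a g * (R - V g) := by
    have := integral_mul_deriv_eq_deriv_mul_of_integrable
      (u := mixDensity p a) (u' := fun g => -(mixDensity p a g * U g)) (v := Φ)
      (v' := fun g => R - V g)
      (fun g _ => hasDerivAt_mixDensity hp a g) (fun g _ => hΦd g) iRV ?_ iΦ
    · rw [this, ← integral_neg]
      refine integral_congr_ae (Filter.Eventually.of_forall fun g => ?_)
      ring
    · refine iUΦ.neg.congr (Filter.Eventually.of_forall fun g => ?_)
      simp only [Pi.neg_apply, Pi.mul_apply]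
      ring
  set P : Ω → ℝ := fun σ => p σ * Real.exp (a σ ^ 2 / 2) with hPdef
  have hZ : 0 < ∑ σ, P σ := Finset.sum_pos (fun σ _ => hP σ) Finset.univ_nonempty
  have hpi : 0 < √(2 * Real.pi) := Real.sqrt_pos.2 (by positivity)
  have iV : Integrable fun g => mixDensity p a g * V g :=
    ibdd _ hVc ⟨R, fun g => by rw [abs_of_nonneg (hV0 g)]; exact hVR g⟩
  have iR : Integrable fun g => mixDensity p a g * R :=
    ibdd _ continuous_const ⟨|R|, fun _ => le_rfl⟩
  have hρ : ∀ g, 0 ≤ mixDensity p a g := fun g =>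
    mul_nonneg (Real.exp_pos _).le (Finset.sum_nonneg fun σ _ => (tilt_pos hp a g σ).le)
  have e1 : ∫ g, mixDensity p a g * wMean (tilt p a g) (fun σ => (b σ - m y) ^ 2) ≤
      ∫ g, mixDensity p a g * R := by
    -- The second moment about `m y` splits into the variance V within a tilt and (m g - m y)²
    -- between tilts. By `key` the latter is at most U Φ, whose integral equals that of R - V.
    have hle : ∀ g, mixDensity p a g * wMean (tilt p a g) (fun σ => (b σ - m y) ^ 2) ≤
        mixDensity p a g * V g + mixDensity p a g * (U g * Φ g) := fun g => by
      rw [wMean_sub_sq (tilt_pos hp a g), ← mul_add]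
      have := key g
      gcongr
      exact hρ g
    calc _ ≤ ∫ g, (mixDensity p a g * V g + mixDensity p a g * (U g * Φ g)) := by
          refine integral_mono ?_ (iV.add iUΦ) hle
          obtain ⟨C, hC⟩ := (Set.finite_range fun σ => |(b σ - m y) ^ 2|).bddAbove
          exact ibdd _ (continuous_wMean_tilt hp a _)
            ⟨C, fun g => abs_wMean_le (tilt_pos hp a g) fun σ => hC ⟨σ, rfl⟩⟩
      _ = ∫ g, (mixDensity p a g * V g + mixDensity p a g * (R - V g)) := by
          rw [integral_add iV iUΦ, parts, integral_add iV iRV]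
      _ = _ := by
          congr 1; ext g; ring
  have e2 : ∫ g, mixDensity p a g * R = √(2 * Real.pi) * ∑ σ, P σ * R := by
    rw [← integral_mixDensity_mul_wMean hp a (fun _ => R)]
    congr 1; ext g
    rw [wMean_const (tilt_pos hp a g)]
  rw [integral_mixDensity_mul_wMean hp, e2, mul_le_mul_iff_right₀ hpi] at e1
  refine (wCov_self_le hP b (m y)).trans ?_
  rw [wMean, div_le_iff₀ hZ, mul_comm R, Finset.sum_mul]
  exact e1

end Tilt

/-! ### Ising models: linear statistics, rank-one updates and independence -/

variable {n : ℕ}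

lemma isingWeight_pos (J : Matrix (Fin n) (Fin n) ℝ) (h : Fin n → ℝ) (σ : Config n) :
    0 < isingWeight J h σ := Real.exp_pos _

lemma spin_mul_self (σ : Config n) (i : Fin n) : spin σ i * spin σ i = 1 := by
  rcases Int.units_eq_one_or (σ i) with h | h <;> simp [spin, h]

lemma abs_spin (σ : Config n) (i : Fin n) : |spin σ i| = 1 := by
  rcases Int.units_eq_one_or (σ i) with h | h <;> simp [spin, h]

/-- The linear statistic `⟨v, σ⟩`. -/
def lin (v : Fin n → ℝ) (σ : Config n) : ℝ := v ⬝ᵥ spin σ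

/-- The variance of `⟨v, σ⟩` under the Ising model `μ_{J,h}`. -/
noncomputable def linVar (J : Matrix (Fin n) (Fin n) ℝ) (h v : Fin n → ℝ) : ℝ :=
  wCov (isingWeight J h) (lin v) (lin v)

/-- The covariance of two spins under the Ising model `μ_{J,h}`. -/
noncomputable def spinCov (J : Matrix (Fin n) (Fin n) ℝ) (h : Fin n → ℝ) (i j : Fin n) : ℝ :=
  wCov (isingWeight J h) (fun σ => spin σ i) (fun σ => spin σ j)

lemma lin_add (v w : Fin n → ℝ) : lin (v + w) = fun σ => lin v σ + lin w σ := by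
  ext σ; simp [lin, add_dotProduct]

lemma lin_smul (c : ℝ) (v : Fin n → ℝ) : lin (c • v) = fun σ => c * lin v σ := by
  ext σ; simp [lin, smul_dotProduct]

lemma linVar_eq_sum (J : Matrix (Fin n) (Fin n) ℝ) (h v : Fin n → ℝ) :
    linVar J h v = ∑ i, ∑ j, v i * v j * spinCov J h i j := by
  have : lin v = fun σ => ∑ i, v i * spin σ i := rfl
  simp only [linVar, this, wCov_sum_left, wCov_sum_right, wCov_const_mul_left,
    wCov_const_mul_right, spinCov, mul_assoc, Finset.mul_sum]
  exact Finset.sum_congr rfl fun i _ => Finset.sum_congr rfl fun j _ => by rw [wCov_comm]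

lemma spinCov_comm (J : Matrix (Fin n) (Fin n) ℝ) (h : Fin n → ℝ) (i j : Fin n) :
    spinCov J h i j = spinCov J h j i := wCov_comm _ _ _

lemma spinCov_self_le_one (J : Matrix (Fin n) (Fin n) ℝ) (h : Fin n → ℝ) (i : Fin n) :
    spinCov J h i i ≤ 1 := by
  refine (wCov_self_le (isingWeight_pos J h) _ 0).trans (le_of_eq ?_)
  simp only [sub_zero, sq, spin_mul_self]
  exact wMean_const (isingWeight_pos J h) 1

lemma cov_ising (J : Matrix (Fin n) (Fin n) ℝ) (h : Fin n → ℝ) (i j : Fin n) :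
    cov (ising J h) i j = spinCov J h i j := by
  simp only [cov, ising, Matrix.of_apply, spinCov, wCov, wMean, partitionFunction,
    div_mul_eq_mul_div, Finset.sum_div]

lemma linVar_add_le (J : Matrix (Fin n) (Fin n) ℝ) (h v w : Fin n → ℝ) {ε : ℝ} (hε : 0 < ε) :
    linVar J h (v + w) ≤ (1 + ε) * linVar J h v + (1 + 1 / ε) * linVar J h w := by
  simp only [linVar, lin_add]
  exact wCov_self_add_le (isingWeight_pos J h) _ _ hε

/-- Tilts by linear statistics stay among Ising models with the same interaction; hence variance
bounds uniform in the field are what the mixture inequality needs. -/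
lemma tilt_isingWeight (J : Matrix (Fin n) (Fin n) ℝ) (h w : Fin n → ℝ) (g : ℝ) :
    tilt (isingWeight J h) (lin w) g = isingWeight J (h + g • w) := by
  ext σ
  simp only [tilt, isingWeight, lin, ← Real.exp_add, add_dotProduct, smul_dotProduct, smul_eq_mul]
  ring_nf

lemma isingWeight_add_vecMulVec (J : Matrix (Fin n) (Fin n) ℝ) (h w : Fin n → ℝ) :
    isingWeight (J + Matrix.vecMulVec w w) h =
      fun σ => isingWeight J h σ * Real.exp (lin w σ ^ 2 / 2) := by
  ext σ
  simp only [isingWeight, lin, ← Real.exp_add, Matrix.add_mulVec, dotProduct_add,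
    Matrix.vecMulVec_mulVec, dotProduct_smul]
  congr 1
  simp only [dotProduct_comm (spin σ) w, MulOpposite.smul_eq_mul_unop, MulOpposite.unop_op]
  ring

/-- A positive rank-one update of the interaction, controlled by the one-dimensional
Brascamp–Lieb inequality. -/
lemma linVar_add_vecMulVec_le (J : Matrix (Fin n) (Fin n) ℝ) (v w : Fin n → ℝ) (R : ℝ)
    (H : ∀ h, ∀ s : ℝ, linVar J h (v + s • w) ≤ R + s ^ 2) (h : Fin n → ℝ) :
    linVar (J + Matrix.vecMulVec w w) h v ≤ R := by
  unfold linVar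
  rw [isingWeight_add_vecMulVec]
  refine wCov_gaussian_mixture_le (isingWeight_pos J h) _ _ _ fun g s => ?_
  have := H (h + g • w) s
  rwa [linVar, ← tilt_isingWeight, lin_add, lin_smul] at this

/-- Adding a positive semidefinite interaction to a model with a uniform covariance bound `q`. -/
lemma linVar_add_sum_vecMulVec_le {ι : Type*} [DecidableEq ι] (J : Matrix (Fin n) (Fin n) ℝ)
    (q : (Fin n → ℝ) → ℝ) (hq : ∀ h v, linVar J h v ≤ q v) (b : ι → Fin n → ℝ) (S : Finset ι)
    (v : Fin n → ℝ) (R : ℝ)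
    (H : ∀ c : ι → ℝ, q (v + ∑ k ∈ S, c k • b k) ≤ R + ∑ k ∈ S, c k ^ 2) (h : Fin n → ℝ) :
    linVar (J + ∑ k ∈ S, Matrix.vecMulVec (b k) (b k)) h v ≤ R := by
  induction S using Finset.induction_on generalizing v R h with
  | empty => simpa using (hq h v).trans (by simpa using H 0)
  | insert k S hk ih =>
    rw [Finset.sum_insert hk, add_comm (Matrix.vecMulVec _ _), ← add_assoc]
    -- The induction hypothesis is applied at the shifted vector v + s b_k with bound R + s²; the s²
    -- is the k-th term of the sum of squares in `H`.
    refine linVar_add_vecMulVec_le _ _ _ _ (fun h s => ih _ _ (fun c => ?_) h) h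
    have := H (Function.update c k s)
    rw [Finset.sum_insert hk, Finset.sum_insert hk, Function.update_self] at this
    have e1 : ∑ i ∈ S, Function.update c k s i • b i = ∑ i ∈ S, c i • b i :=
      Finset.sum_congr rfl fun i hi => by
        rw [Function.update_of_ne (ne_of_mem_of_not_mem hi hk)]
    have e2 : ∑ i ∈ S, Function.update c k s i ^ 2 = ∑ i ∈ S, c i ^ 2 :=
      Finset.sum_congr rfl fun i hi => by
        rw [Function.update_of_ne (ne_of_mem_of_not_mem hi hk)]
    rw [e1, e2, ← add_assoc, ← add_assoc] at this
    exact this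

section Independence

open Classical in
/-- Under a product weight, functions of the two groups of coordinates are uncorrelated. -/
lemma sum_mul_sum_eq_of_dependsOn {U : Set (Fin n)} {W₁ W₂ F G : Config n → ℝ}
    (h₁ : DependsOn W₁ U) (h₂ : DependsOn W₂ Uᶜ) (hF : DependsOn F U) (hG : DependsOn G Uᶜ) :
    (∑ σ, W₁ σ * W₂ σ * (F σ * G σ)) * ∑ σ, W₁ σ * W₂ σ =
      (∑ σ, W₁ σ * W₂ σ * F σ) * ∑ σ, W₁ σ * W₂ σ * G σ := by
  have hU : ∀ {f : Config n → ℝ}, DependsOn f U → ∀ σ τ, f (U.piecewise σ τ) = f σ :=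
    fun hf σ τ => hf fun i hi => Set.piecewise_eq_of_mem _ _ _ hi
  have hUc : ∀ {f : Config n → ℝ}, DependsOn f Uᶜ → ∀ σ τ, f (U.piecewise σ τ) = f τ :=
    fun hf σ τ => hf fun i hi => Set.piecewise_eq_of_notMem _ _ _ hi
  simp only [Fintype.sum_mul_sum, ← Fintype.sum_prod_type']
  -- Two independent copies: exchanging their coordinates outside U matches the two double sums term
  -- by term.
  let e : Config n × Config n → Config n × Config n :=
    fun x => (U.piecewise x.1 x.2, U.piecewise x.2 x.1)
  have he : Function.Involutive e := fun x => by
    refine Prod.ext ?_ ?_ <;> funext i <;> by_cases hi : i ∈ U <;> simp [e, hi]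
  refine Fintype.sum_equiv he.toPerm _ _ fun x => ?_
  simp only [Function.Involutive.coe_toPerm, e, hU h₁, hUc h₂, hU hF, hUc hG]
  ring

lemma wMean_mul_of_dependsOn {U : Set (Fin n)} {W₁ W₂ F G : Config n → ℝ}
    (hp₁ : ∀ σ, 0 < W₁ σ) (hp₂ : ∀ σ, 0 < W₂ σ)
    (h₁ : DependsOn W₁ U) (h₂ : DependsOn W₂ Uᶜ) (hF : DependsOn F U) (hG : DependsOn G Uᶜ) :
    wMean (fun σ => W₁ σ * W₂ σ) (fun σ => F σ * G σ) =
      wMean (fun σ => W₁ σ * W₂ σ) F * wMean (fun σ => W₁ σ * W₂ σ) G := by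
  have hZ : 0 < ∑ σ, W₁ σ * W₂ σ :=
    Finset.sum_pos (fun σ _ => mul_pos (hp₁ σ) (hp₂ σ)) Finset.univ_nonempty
  unfold wMean
  rw [div_mul_div_comm, div_eq_div_iff hZ.ne' (by positivity), ← mul_assoc,
    sum_mul_sum_eq_of_dependsOn h₁ h₂ hF hG]

lemma sinh_le_mul_cosh {x : ℝ} (hx : 0 ≤ x) : Real.sinh x ≤ x * Real.cosh x := by
  have hd : ∀ y, HasDerivAt (fun y => y * Real.cosh y - Real.sinh y) (y * Real.sinh y) y :=
    fun y => (((hasDerivAt_id y).mul (Real.hasDerivAt_cosh y)).sub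
      (Real.hasDerivAt_sinh y)).congr_deriv (by simp)
  have hm : Monotone fun y => y * Real.cosh y - Real.sinh y := by
    refine monotone_of_deriv_nonneg (fun y => (hd y).differentiableAt) fun y => ?_
    rw [(hd y).deriv]
    rcases le_total 0 y with h | h
    · exact mul_nonneg h (Real.sinh_nonneg_iff.2 h)
    · exact mul_nonneg_of_nonpos_of_nonpos h (Real.sinh_nonpos_iff.2 h)
  have := hm hx
  simp only [Real.sinh_zero] at this
  linarith

lemma abs_sinh_div_cosh_le (x : ℝ) : |Real.sinh x / Real.cosh x| ≤ |x| := by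
  rw [abs_div, Real.abs_sinh, abs_of_pos (Real.cosh_pos x), div_le_iff₀ (Real.cosh_pos x)]
  simpa using sinh_le_mul_cosh (abs_nonneg x)

/-- If two groups of spins interact only through the product of the signs `F` and `G`, then
covariances with `F` are transmitted through `G`, with a loss of at least the coupling `θ`. -/
lemma exists_wCov_eq_mul {U : Set (Fin n)} {W₁ W₂ F G : Config n → ℝ} (θ : ℝ)
    (hp₁ : ∀ σ, 0 < W₁ σ) (hp₂ : ∀ σ, 0 < W₂ σ)
    (h₁ : DependsOn W₁ U) (h₂ : DependsOn W₂ Uᶜ) (hF : DependsOn F U) (hG : DependsOn G Uᶜ)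
    (hF1 : ∀ σ, F σ = 1 ∨ F σ = -1) (hG1 : ∀ σ, G σ = 1 ∨ G σ = -1) :
    ∃ b : ℝ, |b| ≤ |θ| ∧ ∀ g : Config n → ℝ, DependsOn g Uᶜ →
      wCov (fun σ => W₁ σ * W₂ σ * Real.exp (θ * (F σ * G σ))) F g =
        b * wCov (fun σ => W₁ σ * W₂ σ * Real.exp (θ * (F σ * G σ))) G g := by
  set Q : Config n → ℝ := fun σ => W₁ σ * W₂ σ with hQ
  have hQp : ∀ σ, 0 < Q σ := fun σ => mul_pos (hp₁ σ) (hp₂ σ)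
  set P : Config n → ℝ := fun σ => W₁ σ * W₂ σ * Real.exp (θ * (F σ * G σ)) with hP
  have hPp : ∀ σ, 0 < P σ := fun σ => mul_pos (hQp σ) (Real.exp_pos _)
  set m := wMean Q F with hm
  have hm1 : |m| ≤ 1 := abs_wMean_le hQp fun σ => by rcases hF1 σ with h | h <;> simp [h]
  have hm2 : m ^ 2 ≤ 1 := (sq_le_one_iff_abs_le_one m).2 hm1
  have hc := Real.cosh_pos θ
  set τ := Real.sinh θ / Real.cosh θ with hτ
  have hτc : Real.sinh θ = τ * Real.cosh θ := by rw [hτ]; field_simp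
  have hτ1 : τ ^ 2 < 1 := by
    rw [hτ, div_pow, div_lt_one (by positivity)]
    nlinarith [Real.cosh_sq θ]
  have hden : 0 < 1 - τ ^ 2 * m ^ 2 := by nlinarith [sq_nonneg m, sq_nonneg τ]
  -- Here τ = tanh θ. Given the spins outside U, the mean of F under P is (m + τG)/(1 + τmG); as G =
  -- ±1 this is affine in G, equal to a + bG. Also |b| ≤ |τ| ≤ |θ|.
  set b := τ * (1 - m ^ 2) / (1 - τ ^ 2 * m ^ 2) with hb
  set a := m * (1 - τ * b) with ha
  have hb' : b = τ * (1 - a * m) := by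
    rw [ha, hb]; field_simp; ring
  have hbθ : |b| ≤ |θ| := by
    refine le_trans ?_ (abs_sinh_div_cosh_le θ)
    rw [hb, mul_div_assoc, abs_mul]
    refine mul_le_of_le_one_right (abs_nonneg _) ?_
    rw [abs_of_nonneg (div_nonneg (by linarith) hden.le), div_le_one hden]
    nlinarith [sq_nonneg m]
  refine ⟨b, hbθ, fun g hg => ?_⟩
  have hexp : ∀ σ, Real.exp (θ * (F σ * G σ)) = Real.cosh θ + Real.sinh θ * (F σ * G σ) := by
    intro σ
    rcases hF1 σ with h | h <;> rcases hG1 σ with h' | h' <;> rw [h, h'] <;> norm_num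
    · rw [← sub_eq_add_neg, Real.cosh_sub_sinh]
    · rw [← sub_eq_add_neg, Real.cosh_sub_sinh]
  -- The residual F - (a + bG) is orthogonal to every function of the spins outside U.
  have hzero : ∀ g : Config n → ℝ, DependsOn g Uᶜ →
      wMean P (fun σ => (F σ + (-a + (-b) * G σ)) * g σ) = 0 := by
    intro g hg
    have hGg : DependsOn (fun σ => G σ * g σ) Uᶜ := fun x y hxy => by
      simp only [hG hxy, hg hxy]
    have hk : DependsOn (fun σ => (Real.cosh θ * (1 - τ * b)) * g σ +
        (-(Real.cosh θ * τ * a)) * (G σ * g σ)) Uᶜ := fun x y hxy => by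
      simp only [hG hxy, hg hxy]
    have hpt : ∀ σ, P σ * ((F σ + (-a + (-b) * G σ)) * g σ) = Q σ *
        (F σ * ((Real.cosh θ * (1 - τ * b)) * g σ + (-(Real.cosh θ * τ * a)) * (G σ * g σ)) +
          ((-(Real.cosh θ * a)) * g σ + (Real.cosh θ * (τ - b)) * (G σ * g σ))) := by
      intro σ
      simp only [hP, hQ, hexp, hτc]
      rcases hF1 σ with h | h <;> rcases hG1 σ with h' | h' <;> rw [h, h'] <;> ring
    have hQ0 : wMean Q (fun σ =>
        F σ * ((Real.cosh θ * (1 - τ * b)) * g σ + (-(Real.cosh θ * τ * a)) * (G σ * g σ)) +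
          ((-(Real.cosh θ * a)) * g σ + (Real.cosh θ * (τ - b)) * (G σ * g σ))) = 0 := by
      rw [wMean_add Q (fun σ => F σ * _), wMean_mul_of_dependsOn hp₁ hp₂ h₁ h₂ hF hk,
        wMean_add, wMean_const_mul, wMean_const_mul, wMean_add, wMean_const_mul, wMean_const_mul,
        ← hm]
      have e1 : m * (Real.cosh θ * (1 - τ * b)) + -(Real.cosh θ * a) = 0 := by rw [ha]; ring
      have e2 : m * (-(Real.cosh θ * τ * a)) + Real.cosh θ * (τ - b) = 0 := by
        linear_combination (-Real.cosh θ) * hb'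
      linear_combination wMean Q g * e1 + wMean Q (fun σ => G σ * g σ) * e2
    have hZQ : 0 < ∑ σ, Q σ := Finset.sum_pos (fun σ _ => hQp σ) Finset.univ_nonempty
    rw [wMean, div_eq_zero_iff] at hQ0
    rw [wMean, Finset.sum_congr rfl fun σ _ => hpt σ, hQ0.resolve_right hZQ.ne', zero_div]
  have hcov : wCov P (fun σ => F σ + (-a + (-b) * G σ)) g = 0 := by
    have h1 := hzero (fun _ => 1) (fun _ _ _ => rfl)
    simp only [mul_one] at h1
    rw [wCov, hzero g hg, h1]; ring
  have hconst : wCov P (fun _ => -a) g = 0 := by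
    rw [wCov, wMean_const_mul, wMean_const hPp]; ring
  rw [wCov_add_left, wCov_add_left, wCov_const_mul_left, hconst] at hcov
  linarith

end Independence

/-! ### Restriction to a set of vertices and the cut-edge identity -/

open Classical in
/-- The interaction `J` with all entries outside `U × U` set to zero. -/
noncomputable def restrict (U : Set (Fin n)) (J : Matrix (Fin n) (Fin n) ℝ) :
    Matrix (Fin n) (Fin n) ℝ :=
  Matrix.of fun i j => if i ∈ U ∧ j ∈ U then J i j else 0

open Classical in
/-- The interaction energy between `U` and its complement. -/
noncomputable def crossEnergy (U : Set (Fin n)) (J : Matrix (Fin n) (Fin n) ℝ) (σ : Config n) :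
    ℝ :=
  ∑ i, ∑ j, if i ∈ U ∧ j ∉ U then J i j * (spin σ i * spin σ j) else 0

lemma isingWeight_eq_exp (J : Matrix (Fin n) (Fin n) ℝ) (h : Fin n → ℝ) (σ : Config n) :
    isingWeight J h σ = Real.exp ((1 / 2) * ∑ i, ∑ j, J i j * (spin σ i * spin σ j) +
      ∑ i, h i * spin σ i) := by
  unfold isingWeight
  congr 2
  simp only [dotProduct, Matrix.mulVec, Finset.mul_sum]
  exact Finset.sum_congr rfl fun i _ => Finset.sum_congr rfl fun j _ => by ring

lemma isingWeight_eq_mul (U : Set (Fin n)) {J : Matrix (Fin n) (Fin n) ℝ} (hJ : J.IsSymm)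
    (h : Fin n → ℝ) (σ : Config n) :
    isingWeight J h σ = isingWeight (restrict U J) (U.indicator h) σ *
      isingWeight (restrict Uᶜ J) (Uᶜ.indicator h) σ * Real.exp (crossEnergy U J σ) := by
  classical
  simp only [isingWeight_eq_exp, ← Real.exp_add]
  congr 1
  have h1 : ∑ i, h i * spin σ i =
      ∑ i, U.indicator h i * spin σ i + ∑ i, Uᶜ.indicator h i * spin σ i := by
    rw [← Finset.sum_add_distrib]
    refine Finset.sum_congr rfl fun i _ => ?_
    by_cases hi : i ∈ U <;> simp [hi]
  have h2 : crossEnergy U J σ = (1 / 2) * ∑ i, ∑ j,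
      ((if i ∈ U ∧ j ∉ U then J i j * (spin σ i * spin σ j) else 0) +
        if j ∈ U ∧ i ∉ U then J j i * (spin σ j * spin σ i) else 0) := by
    simp only [Finset.sum_add_distrib]
    rw [Finset.sum_comm (f := fun i j =>
      if j ∈ U ∧ i ∉ U then J j i * (spin σ j * spin σ i) else 0)]
    unfold crossEnergy
    ring
  have h3 : ∑ i, ∑ j, J i j * (spin σ i * spin σ j) =
      ∑ i, ∑ j, restrict U J i j * (spin σ i * spin σ j) +
        ∑ i, ∑ j, restrict Uᶜ J i j * (spin σ i * spin σ j) + ∑ i, ∑ j,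
      ((if i ∈ U ∧ j ∉ U then J i j * (spin σ i * spin σ j) else 0) +
        if j ∈ U ∧ i ∉ U then J j i * (spin σ j * spin σ i) else 0) := by
    simp only [← Finset.sum_add_distrib]
    refine Finset.sum_congr rfl fun i _ => Finset.sum_congr rfl fun j _ => ?_
    have := hJ.apply i j
    by_cases hi : i ∈ U <;> by_cases hj : j ∈ U <;> simp [restrict, hi, hj, this, mul_comm]
  rw [h1, h2, h3]
  ring

lemma dependsOn_isingWeight_restrict (U : Set (Fin n)) (J : Matrix (Fin n) (Fin n) ℝ)
    (h : Fin n → ℝ) : DependsOn (isingWeight (restrict U J) (U.indicator h)) U := by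
  intro σ τ hστ
  have hs : ∀ i ∈ U, spin σ i = spin τ i := fun i hi => by simp [spin, hστ i hi]
  rw [isingWeight_eq_exp, isingWeight_eq_exp]
  congr 2
  · congr 1
    refine Finset.sum_congr rfl fun i _ => Finset.sum_congr rfl fun j _ => ?_
    by_cases hij : i ∈ U ∧ j ∈ U
    · rw [hs i hij.1, hs j hij.2]
    · simp [restrict, hij]
  · refine Finset.sum_congr rfl fun i _ => ?_
    by_cases hi : i ∈ U
    · rw [hs i hi]
    · simp [hi]

lemma dependsOn_spin {U : Set (Fin n)} {i : Fin n} (hi : i ∈ U) :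
    DependsOn (fun σ : Config n => spin σ i) U := fun σ τ h => by simp [spin, h i hi]

lemma dependsOn_lin {U : Set (Fin n)} {v : Fin n → ℝ} (hv : ∀ i ∉ U, v i = 0) :
    DependsOn (lin v) U := fun σ τ h => by
  simp only [lin, dotProduct]
  refine Finset.sum_congr rfl fun i _ => ?_
  by_cases hi : i ∈ U
  · simp [spin, h i hi]
  · simp [hv i hi]

lemma spin_eq_one_or (σ : Config n) (i : Fin n) : spin σ i = 1 ∨ spin σ i = -1 := by
  rcases Int.units_eq_one_or (σ i) with h | h <;> simp [spin, h]

/-- Spins on the two sides of a cut edge. -/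
lemma exists_spinCov_eq_mul {U : Set (Fin n)} {J : Matrix (Fin n) (Fin n) ℝ} (hJ : J.IsSymm)
    (h : Fin n → ℝ) {u p : Fin n} (hu : u ∈ U) (hp : p ∉ U)
    (hcut : ∀ i ∈ U, ∀ j ∉ U, ¬ (i = u ∧ j = p) → J i j = 0) :
    ∃ b : ℝ, |b| ≤ |J u p| ∧ ∀ v ∉ U, spinCov J h u v = b * spinCov J h p v := by
  classical
  have hw : isingWeight J h = fun σ => isingWeight (restrict U J) (U.indicator h) σ *
      isingWeight (restrict Uᶜ J) (Uᶜ.indicator h) σ *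
        Real.exp (J u p * (spin σ u * spin σ p)) := by
    ext σ
    rw [isingWeight_eq_mul U hJ]
    congr 2
    unfold crossEnergy
    rw [Finset.sum_eq_single u, Finset.sum_eq_single p]
    · simp [hu, hp]
    · intro j _ hj
      by_cases hjU : j ∈ U
      · simp [hjU]
      · simp [hjU, hcut u hu j hjU (by simp [hj])]
    · simp
    · intro i _ hi
      refine Finset.sum_eq_zero fun j _ => ?_
      split_ifs with hij
      · simp [hcut i hij.1 j hij.2 (by simp [hi])]
      · rfl
    · simp
  obtain ⟨b, hb, hcov⟩ := exists_wCov_eq_mul (J u p) (isingWeight_pos _ _) (isingWeight_pos _ _)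
    (dependsOn_isingWeight_restrict U J h) (dependsOn_isingWeight_restrict Uᶜ J h)
    (dependsOn_spin hu) (dependsOn_spin (U := Uᶜ) hp) (fun σ => spin_eq_one_or σ u)
    (fun σ => spin_eq_one_or σ p)
  refine ⟨b, hb, fun v hv => ?_⟩
  simp only [spinCov, hw]
  exact hcov _ (dependsOn_spin (U := Uᶜ) hv)

lemma isingWeight_eq_mul_of_cut {U : Set (Fin n)} {J : Matrix (Fin n) (Fin n) ℝ} (hJ : J.IsSymm)
    (h : Fin n → ℝ) (hcut : ∀ i ∈ U, ∀ j ∉ U, J i j = 0) :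
    isingWeight J h = fun σ => isingWeight (restrict U J) (U.indicator h) σ *
      isingWeight (restrict Uᶜ J) (Uᶜ.indicator h) σ := by
  ext σ
  have : crossEnergy U J σ = 0 := by
    refine Finset.sum_eq_zero fun i _ => Finset.sum_eq_zero fun j _ => ?_
    split_ifs with hij
    · simp [hcut i hij.1 j hij.2]
    · rfl
  rw [isingWeight_eq_mul U hJ, this, Real.exp_zero, mul_one]

lemma spinCov_eq_zero_of_cut {U : Set (Fin n)} {J : Matrix (Fin n) (Fin n) ℝ} (hJ : J.IsSymm)
    (h : Fin n → ℝ) (hcut : ∀ i ∈ U, ∀ j ∉ U, J i j = 0) {u v : Fin n} (hu : u ∈ U)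
    (hv : v ∉ U) : spinCov J h u v = 0 := by
  rw [spinCov, isingWeight_eq_mul_of_cut hJ h hcut, wCov,
    wMean_mul_of_dependsOn (isingWeight_pos _ _) (isingWeight_pos _ _)
      (dependsOn_isingWeight_restrict U J h) (dependsOn_isingWeight_restrict Uᶜ J h)
      (dependsOn_spin hu) (dependsOn_spin (U := Uᶜ) hv), sub_self]

lemma wMean_mul_eq_of_dependsOn {U : Set (Fin n)} {W₁ W₂ F : Config n → ℝ}
    (hp₁ : ∀ σ, 0 < W₁ σ) (hp₂ : ∀ σ, 0 < W₂ σ)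
    (h₁ : DependsOn W₁ U) (h₂ : DependsOn W₂ Uᶜ) (hF : DependsOn F U) :
    wMean (fun σ => W₁ σ * W₂ σ) F = wMean W₁ F := by
  have hZ : 0 < ∑ σ, W₁ σ * W₂ σ :=
    Finset.sum_pos (fun σ _ => mul_pos (hp₁ σ) (hp₂ σ)) Finset.univ_nonempty
  have hZ₁ : 0 < ∑ σ, W₁ σ := Finset.sum_pos (fun σ _ => hp₁ σ) Finset.univ_nonempty
  -- The replica identity is used with trivial second weight, `W₂` itself playing the observable.
  have := sum_mul_sum_eq_of_dependsOn (W₂ := fun _ => 1) h₁ (fun _ _ _ => rfl) hF h₂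
  simp only [mul_one] at this
  rw [wMean, wMean, div_eq_div_iff hZ.ne' hZ₁.ne', ← this]
  congr 1
  exact Finset.sum_congr rfl fun σ _ => by ring

/-- The law of the spins in `U` does not feel the rest of the system if no edge leaves `U`. -/
lemma linVar_restrict {U : Set (Fin n)} {J : Matrix (Fin n) (Fin n) ℝ} (hJ : J.IsSymm)
    (h : Fin n → ℝ) (hcut : ∀ i ∈ U, ∀ j ∉ U, J i j = 0) {v : Fin n → ℝ}
    (hv : ∀ i ∉ U, v i = 0) :
    linVar J h v = linVar (restrict U J) (U.indicator h) v := by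
  have hl := dependsOn_lin hv
  have hE : ∀ F : Config n → ℝ, DependsOn F U →
      wMean (isingWeight J h) F = wMean (isingWeight (restrict U J) (U.indicator h)) F :=
    fun F hF => by
      rw [isingWeight_eq_mul_of_cut hJ h hcut]
      exact wMean_mul_eq_of_dependsOn (isingWeight_pos _ _) (isingWeight_pos _ _)
        (dependsOn_isingWeight_restrict U J h) (dependsOn_isingWeight_restrict Uᶜ J h) hF
  unfold linVar wCov
  rw [hE _ hl, hE (fun σ => lin v σ * lin v σ) fun x y hxy => by simp only [hl hxy]]

/-! ### Ising models on forests -/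

section Forest

variable {par : Fin n → Fin n} {ord : Fin n → ℕ}

lemma ord_lt_of_iterate_eq (hpar : ∀ u, par u = u ∨ ord (par u) < ord u) (k : ℕ) {v u : Fin n}
    (hk : par^[k] v = u) (huv : v ≠ u) : ord u < ord v := by
  induction k generalizing v with
  | zero => exact absurd hk huv
  | succ k ih =>
    rw [Function.iterate_succ_apply] at hk
    rcases hpar v with h | h
    · rw [h] at hk; exact ih hk huv
    · by_cases hv : par v = u
      · rwa [hv] at h
      · exact (ih hk hv).trans h

/-- Decay of correlations on a rooted forest, with arbitrary external fields. -/
lemma exists_abs_spinCov_le (hpar : ∀ u, par u = u ∨ ord (par u) < ord u)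
    {J : Matrix (Fin n) (Fin n) ℝ} (hJ : J.IsSymm) (h : Fin n → ℝ) {ρ : ℝ} (hρ : 0 ≤ ρ)
    (hsupp : ∀ i j, i ≠ j → J i j ≠ 0 → j = par i ∨ i = par j)
    (hb : ∀ i j, i ≠ j → |J i j| ≤ ρ) (u v : Fin n) :
    spinCov J h u v = 0 ∨ ∃ a ≤ ord u, ∃ b ≤ ord v,
      par^[a] u = par^[b] v ∧ |spinCov J h u v| ≤ ρ ^ (a + b) := by
  induction hN : ord u + ord v using Nat.strong_induction_on generalizing u v with
  | _ N ih =>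
  -- The vertex of larger order is the one moved to its parent, so the other vertex cannot be among
  -- its descendants.
  wlog huv : ord v ≤ ord u generalizing u v
  · rcases this v u (by omega) (by omega) with h0 | ⟨a, ha, b, hb, hab, hle⟩
    · exact Or.inl (spinCov_comm J h u v ▸ h0)
    · exact Or.inr ⟨b, hb, a, ha, hab.symm, by rwa [spinCov_comm, add_comm]⟩
  by_cases heq : u = v
  · subst heq
    refine Or.inr ⟨0, Nat.zero_le _, 0, Nat.zero_le _, rfl, ?_⟩
    have h0 : 0 ≤ spinCov J h u u := wCov_self_nonneg (isingWeight_pos J h) _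
    rw [abs_of_nonneg h0]
    simpa using spinCov_self_le_one J h u
  -- The descendants of u: only the edge to `par u` can leave this set, and no edge does when u is a
  -- root.
  set U : Set (Fin n) := {w | ∃ k, par^[k] w = u} with hU
  have huU : u ∈ U := ⟨0, rfl⟩
  have hvU : v ∉ U := fun ⟨k, hk⟩ => by
    have := ord_lt_of_iterate_eq hpar k hk (Ne.symm heq)
    omega
  have hcut : ∀ i ∈ U, ∀ j ∉ U, ¬ (i = u ∧ j = par u) → J i j = 0 := by
    rintro i ⟨k, hk⟩ j hj hij
    by_contra hne
    have hij' : i ≠ j := fun e => hj (e ▸ ⟨k, hk⟩)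
    rcases hsupp i j hij' hne with rfl | rfl
    · cases k with
      | zero => exact hij ⟨hk, congrArg par hk⟩
      | succ k => exact hj ⟨k, hk⟩
    · exact hj ⟨k + 1, hk⟩
  by_cases hroot : par u = u
  · left
    refine spinCov_eq_zero_of_cut hJ h (fun i hi j hj => hcut i hi j hj ?_) huU hvU
    rintro ⟨-, rfl⟩
    exact hj (hroot.symm ▸ huU)
  have hlt : ord (par u) < ord u := (hpar u).resolve_left hroot
  have hpU : par u ∉ U := fun ⟨k, hk⟩ => by
    have := ord_lt_of_iterate_eq hpar k hk hroot
    omega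
  obtain ⟨b, hbJ, hcov⟩ := exists_spinCov_eq_mul hJ h huU hpU hcut
  rw [hcov v hvU]
  rcases ih (ord (par u) + ord v) (by omega) (par u) v rfl with h0 | ⟨a, ha, c, hc, hac, hle⟩
  · left; rw [h0, mul_zero]
  · refine Or.inr ⟨a + 1, by omega, c, hc, hac, ?_⟩
    rw [abs_mul, show a + 1 + c = (a + c) + 1 by ring, pow_succ, mul_comm]
    exact mul_le_mul hle (hbJ.trans (hb u _ (Ne.symm hroot))) (abs_nonneg _) (pow_nonneg hρ _)

/-- The variance of a linear statistic on a rooted forest, in terms of the growth of the set of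
`a`-th descendants. -/
lemma linVar_le_of_forest (hpar : ∀ u, par u = u ∨ ord (par u) < ord u)
    {J : Matrix (Fin n) (Fin n) ℝ} (hJ : J.IsSymm) (h : Fin n → ℝ) {γ D c : ℝ}
    (hγ0 : 0 ≤ γ) (hγ1 : γ < 1) (hD : 0 < D) (hc : 0 ≤ c)
    (hsupp : ∀ i j, i ≠ j → J i j ≠ 0 → j = par i ∨ i = par j)
    (hb : ∀ i j, i ≠ j → |J i j| ≤ γ / √D) (T : Set (Fin n))
    (hT : ∀ a w, ({u ∈ T | par^[a] u = w}.ncard : ℝ) ≤ c * D ^ a)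
    (x : Fin n → ℝ) (hx : ∀ i ∉ T, x i = 0) :
    linVar J h x ≤ c / (1 - γ) ^ 2 * ∑ i, x i ^ 2 := by
  classical
  have hsD : 0 < √D := Real.sqrt_pos.2 hD
  set ρ := γ / √D with hρdef
  have hρ : 0 ≤ ρ := div_nonneg hγ0 hsD.le
  -- The bounds a ≤ ord u and b ≤ ord v in the decay estimate allow all sums over generations to
  -- stop at N.
  set N := Finset.univ.sup ord + 1 with hN
  have hord : ∀ u, ord u < N := fun u =>
    Nat.lt_succ_of_le (Finset.le_sup (f := ord) (Finset.mem_univ u))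
  -- `L` spreads u over its ancestors with weight ρᵃ; a common ancestor shows that LᵀL dominates the
  -- absolute covariances entrywise.
  set L : Fin n → Fin n → ℝ := fun w u =>
    ∑ a ∈ Finset.range N, ρ ^ a * if par^[a] u = w then 1 else 0 with hL
  have hL0 : ∀ w u, 0 ≤ L w u := fun w u =>
    Finset.sum_nonneg fun a _ => mul_nonneg (pow_nonneg hρ a) (by split_ifs <;> simp)
  have hL1 : ∀ u, ∀ a < N, ρ ^ a ≤ L (par^[a] u) u := fun u a ha => by
    have := Finset.single_le_sum (f := fun a' => ρ ^ a' * if par^[a'] u = par^[a] u then 1 else 0)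
      (fun a' _ => mul_nonneg (pow_nonneg hρ a') (by split_ifs <;> simp)) (Finset.mem_range.2 ha)
    simpa [hL] using this
  have hcov : ∀ u v, |spinCov J h u v| ≤ ∑ w, L w u * L w v := fun u v => by
    rcases exists_abs_spinCov_le hpar hJ h hρ hsupp hb u v with h0 | ⟨a, ha, b, hb, hab, hle⟩
    · rw [h0, abs_zero]
      exact Finset.sum_nonneg fun w _ => mul_nonneg (hL0 w u) (hL0 w v)
    · refine hle.trans ?_
      refine le_trans ?_ (Finset.single_le_sum (f := fun w => L w u * L w v)
        (fun w _ => mul_nonneg (hL0 w u) (hL0 w v)) (Finset.mem_univ (par^[a] u)))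
      rw [pow_add]
      refine mul_le_mul (hL1 u a (ha.trans_lt (hord u))) ?_ (pow_nonneg hρ _) (hL0 _ _)
      rw [hab]
      exact hL1 v b (hb.trans_lt (hord v))
  set y : ℕ → Fin n → ℝ := fun a w => ∑ u with u ∈ T ∧ par^[a] u = w, |x u| with hy
  have hLy : ∀ w, ∑ u, L w u * |x u| = ∑ a ∈ Finset.range N, ρ ^ a * y a w := fun w => by
    simp only [hL, hy, Finset.sum_mul, Finset.mul_sum]
    rw [Finset.sum_comm]
    refine Finset.sum_congr rfl fun a _ => ?_
    rw [Finset.sum_filter]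
    refine Finset.sum_congr rfl fun u _ => ?_
    by_cases hu : u ∈ T
    · by_cases hw : par^[a] u = w <;> simp [hu, hw]
    · simp [hu, hx u hu]
  have h1 : linVar J h x ≤ ∑ w, (∑ a ∈ Finset.range N, ρ ^ a * y a w) ^ 2 := by
    rw [linVar_eq_sum]
    calc ∑ i, ∑ j, x i * x j * spinCov J h i j
        ≤ ∑ i, ∑ j, |x i| * |x j| * ∑ w, L w i * L w j := by
          refine Finset.sum_le_sum fun i _ => Finset.sum_le_sum fun j _ => ?_
          refine (le_abs_self _).trans ?_
          rw [abs_mul, abs_mul]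
          exact mul_le_mul_of_nonneg_left (hcov i j) (by positivity)
      _ = ∑ w, (∑ u, L w u * |x u|) ^ 2 := by
          simp only [Finset.mul_sum]
          rw [Finset.sum_comm_cycle]
          refine Finset.sum_congr rfl fun w _ => ?_
          rw [sq, Finset.sum_mul_sum]
          refine Finset.sum_congr rfl fun i _ => Finset.sum_congr rfl fun j _ => ?_
          ring
      _ = _ := by simp only [hLy]
  set S := ∑ a ∈ Finset.range N, γ ^ a with hS
  have hS0 : 0 ≤ S := Finset.sum_nonneg fun a _ => pow_nonneg hγ0 a
  have hS1 : S ≤ 1 / (1 - γ) := by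
    rw [le_div_iff₀ (by linarith), hS, geom_sum_mul_neg]
    linarith [pow_nonneg hγ0 N]
  -- Cauchy–Schwarz with ρᵃ = γᵃ/D^{a/2}: one factor 1/(1-γ) arises here as S, the other from
  -- summing γᵃ at the end.
  have h2 : ∀ w, (∑ a ∈ Finset.range N, ρ ^ a * y a w) ^ 2 ≤
      S * ∑ a ∈ Finset.range N, γ ^ a * (y a w ^ 2 / D ^ a) := fun w => by
    refine Finset.sum_sq_le_sum_mul_sum_of_sq_le_mul _ (fun a _ => pow_nonneg hγ0 a)
      (fun a _ => mul_nonneg (pow_nonneg hγ0 a) (by positivity)) fun a _ => le_of_eq ?_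
    rw [hρdef, div_pow, mul_pow, div_pow, ← pow_mul √D, mul_comm a 2, pow_mul, Real.sq_sqrt hD.le]
    field_simp
  -- The descendant count cancels Dᵃ, and every u lies over exactly one a-th ancestor w.
  have h3 : ∀ a, ∑ w, y a w ^ 2 / D ^ a ≤ c * ∑ i, x i ^ 2 := fun a => by
    calc ∑ w, y a w ^ 2 / D ^ a ≤ ∑ w, c * ∑ u with par^[a] u = w, x u ^ 2 := by
          refine Finset.sum_le_sum fun w _ => ?_
          rw [div_le_iff₀ (by positivity)]
          have hcard : (({u | u ∈ T ∧ par^[a] u = w} : Finset (Fin n)).card : ℝ) ≤ c * D ^ a := by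
            have := hT a w
            rwa [Set.ncard_eq_toFinset_card', Set.toFinset_ofPred] at this
          calc y a w ^ 2 ≤ _ := sq_sum_le_card_mul_sum_sq
            _ ≤ (c * D ^ a) * ∑ u with par^[a] u = w, x u ^ 2 := by
                refine mul_le_mul hcard ?_ (Finset.sum_nonneg fun _ _ => sq_nonneg _)
                  (by positivity)
                simp only [sq_abs]
                refine Finset.sum_le_sum_of_subset_of_nonneg ?_ fun _ _ _ => sq_nonneg _
                exact fun u hu => by simp at hu ⊢; exact hu.2
            _ = _ := by ring
      _ = _ := by rw [← Finset.mul_sum, Finset.sum_fiberwise]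
  calc linVar J h x ≤ ∑ w, S * ∑ a ∈ Finset.range N, γ ^ a * (y a w ^ 2 / D ^ a) :=
        h1.trans (Finset.sum_le_sum fun w _ => h2 w)
    _ = S * ∑ a ∈ Finset.range N, γ ^ a * ∑ w, y a w ^ 2 / D ^ a := by
        rw [← Finset.mul_sum, Finset.sum_comm]
        simp only [Finset.mul_sum]
    _ ≤ S * ∑ a ∈ Finset.range N, γ ^ a * (c * ∑ i, x i ^ 2) := by
        gcongr with a
        exact h3 a
    _ = S ^ 2 * (c * ∑ i, x i ^ 2) := by rw [← Finset.sum_mul]; ring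
    _ ≤ (1 / (1 - γ)) ^ 2 * (c * ∑ i, x i ^ 2) := by
        gcongr
    _ = _ := by rw [one_div, inv_pow]; ring

end Forest

/-! ### A forest with one additional edge -/

open Classical in
/-- The interaction `J` with the coupling between `p` and `q` removed. -/
noncomputable def eraseEdge (J : Matrix (Fin n) (Fin n) ℝ) (p q : Fin n) :
    Matrix (Fin n) (Fin n) ℝ :=
  Matrix.of fun i j => if s(i, j) = s(p, q) then 0 else J i j

lemma isingWeight_eraseEdge {J : Matrix (Fin n) (Fin n) ℝ} (hJ : J.IsSymm) (h : Fin n → ℝ)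
    {p q : Fin n} (hpq : p ≠ q) (σ : Config n) :
    isingWeight J h σ =
      Real.exp (J p q * (spin σ p * spin σ q)) * isingWeight (eraseEdge J p q) h σ := by
  classical
  rw [isingWeight_eq_exp, isingWeight_eq_exp, ← Real.exp_add, ← add_assoc]
  congr 2
  have h1 : ∀ i j, J i j * (spin σ i * spin σ j) =
      eraseEdge J p q i j * (spin σ i * spin σ j) +
        ((if i = p then if j = q then J p q * (spin σ p * spin σ q) else 0 else 0) +
          if i = q then if j = p then J p q * (spin σ p * spin σ q) else 0 else 0) := by
    intro i j
    have := hJ.apply p q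
    by_cases hip : i = p
    · subst hip
      by_cases hjq : j = q
      · subst hjq; simp [eraseEdge, hpq]
      · simp [eraseEdge, hjq, hpq]
    · by_cases hiq : i = q
      · subst hiq
        by_cases hjp : j = p
        · subst hjp; simp [eraseEdge, hip, this, mul_comm]
        · simp [eraseEdge, hip, hjp]
      · simp [eraseEdge, hip, hiq]
  rw [Finset.sum_congr rfl fun i _ => Finset.sum_congr rfl fun j _ => h1 i j]
  simp only [Finset.sum_add_distrib, Finset.sum_ite_eq', Finset.sum_ite_irrel,
    Finset.sum_const_zero, Finset.mem_univ, if_true]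
  ring

/-- Removing a coupling changes every weight by a factor in [e^{-ρ}, e^{ρ}], so comparison of
variances applies. -/
lemma linVar_le_exp_mul_eraseEdge {J : Matrix (Fin n) (Fin n) ℝ} (hJ : J.IsSymm)
    (h : Fin n → ℝ) {p q : Fin n} (hpq : p ≠ q) {ρ : ℝ} (hρ : |J p q| ≤ ρ) (x : Fin n → ℝ) :
    linVar J h x ≤ Real.exp (2 * ρ) * linVar (eraseEdge J p q) h x := by
  have hb : ∀ σ : Config n, |J p q * (spin σ p * spin σ q)| ≤ ρ := fun σ => by
    simpa [abs_mul, abs_spin] using hρ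
  refine wCov_self_le_of_weight_le (isingWeight_pos _ _) (isingWeight_pos _ _)
    (fun σ => ?_) (fun σ => ?_) _ <;> rw [isingWeight_eraseEdge hJ h hpq]
  · exact mul_le_mul_of_nonneg_right (Real.exp_le_exp.2 (abs_le.1 (hb σ)).2)
      (isingWeight_pos _ _ _).le
  · exact mul_le_mul_of_nonneg_right (Real.exp_le_exp.2 (abs_le.1 (hb σ)).1)
      (isingWeight_pos _ _ _).le

lemma linVar_le_of_unicyclic {par : Fin n → Fin n} {ord : Fin n → ℕ}
    (hpar : ∀ u, par u = u ∨ ord (par u) < ord u)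
    {J : Matrix (Fin n) (Fin n) ℝ} (hJ : J.IsSymm) (h : Fin n → ℝ) {γ D c : ℝ}
    (hγ0 : 0 ≤ γ) (hγ1 : γ < 1) (hD : 0 < D) (hc : 0 ≤ c) (e : Sym2 (Fin n))
    (hsupp : ∀ i j, i ≠ j → J i j ≠ 0 → j = par i ∨ i = par j ∨ s(i, j) = e)
    (hb : ∀ i j, i ≠ j → |J i j| ≤ γ / √D) (T : Set (Fin n))
    (hT : ∀ a w, ({u ∈ T | par^[a] u = w}.ncard : ℝ) ≤ c * D ^ a)
    (x : Fin n → ℝ) (hx : ∀ i ∉ T, x i = 0) :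
    linVar J h x ≤ c * (Real.exp (2 * γ / √D) / (1 - γ) ^ 2) * ∑ i, x i ^ 2 := by
  classical
  induction e with | _ p q
  have hρ : 0 ≤ γ / √D := div_nonneg hγ0 (Real.sqrt_nonneg _)
  have hS : 0 ≤ ∑ i, x i ^ 2 := Finset.sum_nonneg fun _ _ => sq_nonneg _
  have hexp : Real.exp (2 * γ / √D) = Real.exp (2 * (γ / √D)) := by rw [mul_div_assoc]
  have hfinal : Real.exp (2 * (γ / √D)) * (c / (1 - γ) ^ 2 * ∑ i, x i ^ 2) =
      c * (Real.exp (2 * γ / √D) / (1 - γ) ^ 2) * ∑ i, x i ^ 2 := by rw [hexp]; ring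
  rw [← hfinal]
  -- A diagonal `e` encodes the absence of an extra edge.
  by_cases hpq : p = q
  · subst hpq
    refine (linVar_le_of_forest hpar hJ h hγ0 hγ1 hD hc (fun i j hij hne => ?_) hb T hT x hx).trans
      (le_mul_of_one_le_left (by positivity) (Real.one_le_exp (by positivity)))
    rcases hsupp i j hij hne with h | h | h
    · exact Or.inl h
    · exact Or.inr h
    · simp only [Sym2.eq_iff, or_self] at h
      exact absurd (h.1.trans h.2.symm) hij
  · refine (linVar_le_exp_mul_eraseEdge hJ h hpq (hb p q hpq) x).trans ?_
    refine mul_le_mul_of_nonneg_left ?_ (Real.exp_pos _).le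
    refine linVar_le_of_forest hpar ?_ h hγ0 hγ1 hD hc (fun i j hij hne => ?_) (fun i j hij => ?_)
      T hT x hx
    · refine Matrix.IsSymm.ext fun i j => ?_
      simp only [eraseEdge, Matrix.of_apply, hJ.apply i j, Sym2.eq_swap (a := j)]
    · simp only [eraseEdge, Matrix.of_apply] at hne
      split_ifs at hne with he
      · exact absurd rfl hne
      · rcases hsupp i j hij hne with h | h | h
        · exact Or.inl h
        · exact Or.inr h
        · exact absurd h he
    · simp only [eraseEdge, Matrix.of_apply]
      split_ifs
      · simpa using hρ
      · exact hb i j hij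

/-- A connected graph with at most as many edges as vertices is a rooted tree together with at
most one additional edge. -/
lemma exists_parent {W : Type*} [Finite W] {F : SimpleGraph W} (hF : F.Connected)
    (hcard : F.edgeSet.ncard ≤ Nat.card W) :
    ∃ (par : W → W) (ord : W → ℕ) (e : Sym2 W),
      (∀ u, par u = u ∨ (F.Adj u (par u) ∧ ord (par u) < ord u)) ∧
        ∀ u v, F.Adj u v → v = par u ∨ u = par v ∨ s(u, v) = e := by
  classical
  obtain ⟨r⟩ := hF.nonempty
  have hnbr : ∀ u, u ≠ r → ∃ w, F.Adj u w ∧ F.dist w r < F.dist u r := fun u hu => by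
    obtain ⟨p, hp⟩ := (hF.preconnected u r).exists_walk_length_eq_dist
    cases p with
    | nil => exact absurd rfl hu
    | cons h p =>
      refine ⟨_, h, ?_⟩
      have := SimpleGraph.dist_le p
      rw [SimpleGraph.Walk.length_cons] at hp
      omega
  choose! f hf using hnbr
  set par : W → W := fun u => if u = r then r else f u with hpar
  have hpr : ∀ u, u ≠ r → F.Adj u (par u) ∧ F.dist (par u) r < F.dist u r := fun u hu => by
    simpa [hpar, hu] using hf u hu
  set P : Set (Sym2 W) := (fun u => s(u, par u)) '' {r}ᶜ with hP
  -- Were u and v each other's parents, each would be strictly closer to r than the other. Hence the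
  -- parent edges number one less than the vertices, leaving at most one further edge.
  have hinj : Set.InjOn (fun u => s(u, par u)) {r}ᶜ := fun u hu v hv huv => by
    rcases Sym2.eq_iff.1 huv with h | h
    · exact h.1
    · have h1 := (hpr u hu).2
      have h2 := (hpr v hv).2
      rw [h.2] at h1
      rw [← h.1] at h2
      omega
  have hPE : P ⊆ F.edgeSet := by
    rintro _ ⟨u, hu, rfl⟩
    exact (hpr u hu).1
  have hPcard : P.ncard + 1 = Nat.card W := by
    rw [hP, hinj.ncard_image, ← Set.ncard_add_ncard_compl {r}, Set.ncard_singleton,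
      add_comm]
  have hle : (F.edgeSet \ P).ncard ≤ 1 := by
    rw [Set.ncard_sdiff hPE]; omega
  have he : ∃ e, ∀ x ∈ F.edgeSet \ P, x = e := by
    rcases (F.edgeSet \ P).eq_empty_or_nonempty with h | ⟨e, he⟩
    · exact ⟨s(r, r), by simp [h]⟩
    · exact ⟨e, fun x hx => (Set.ncard_le_one_iff (Set.toFinite _)).1 hle hx he⟩
  obtain ⟨e, he⟩ := he
  refine ⟨par, fun u => F.dist u r, e, fun u => ?_, fun u v huv => ?_⟩
  · by_cases hu : u = r
    · left; simp [hpar, hu]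
    · exact Or.inr (hpr u hu)
  · by_cases hx : s(u, v) ∈ P
    · obtain ⟨w, -, hw⟩ := hx
      rcases Sym2.eq_iff.1 hw with ⟨rfl, rfl⟩ | ⟨rfl, rfl⟩
      · exact Or.inl rfl
      · exact Or.inr (Or.inl rfl)
    · exact Or.inr (Or.inr (he _ ⟨huv, hx⟩))

/-! ### Ising models on near-forests -/

/-- This places a-th descendants in the ball of radius a about their ancestor, so that ball growth
controls the descendant count. -/
lemma edist_iterate_le {V W : Type*} (F : SimpleGraph V) (j : W → V) {par : W → W}
    (hpar : ∀ u, par u = u ∨ F.Adj (j u) (j (par u))) (a : ℕ) (u : W) :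
    F.edist (j (par^[a] u)) (j u) ≤ a := by
  induction a generalizing u with
  | zero => simp
  | succ a ih =>
    rw [Function.iterate_succ_apply]
    have h1 : F.edist (j (par u)) (j u) ≤ 1 := by
      rw [SimpleGraph.edist_le_one_iff_adj_or_eq]
      rcases hpar u with h | h
      · right; rw [h]
      · exact Or.inl h.symm
    calc _ ≤ _ := F.edist_triangle
      _ ≤ (a : ℕ∞) + 1 := add_le_add (ih (par u)) h1
      _ = _ := by push_cast; rfl

/-- The variance of a linear statistic supported on one component of a near-forest. -/
lemma linVar_le_of_component {G : SimpleGraph (Fin n)} (H : G.Subgraph)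
    (C : H.coe.ConnectedComponent) (hC : treeExcess C.toSimpleGraph ≤ 1)
    {J : Matrix (Fin n) (Fin n) ℝ} (hJ : J.IsSymm) (hJH : SupportedOn J H) (h : Fin n → ℝ)
    {γ D c : ℝ} (hγ0 : 0 ≤ γ) (hγ1 : γ < 1) (hD : 0 < D) (hc : 0 ≤ c)
    (hb : ∀ i j, i ≠ j → |J i j| ≤ γ / √D) (T : Set (Fin n))
    (hT : ∀ (a : ℕ) (u : H.verts),
      ({v : H.verts | (v : Fin n) ∈ T ∧ H.coe.edist u v ≤ a}.ncard : ℝ) ≤ c * D ^ a)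
    (x : Fin n → ℝ) (hx : ∀ i, x i ≠ 0 → i ∈ T ∧ ∃ w : C, ((w : H.verts) : Fin n) = i) :
    linVar J h x ≤ c * (Real.exp (2 * γ / √D) / (1 - γ) ^ 2) * ∑ i, x i ^ 2 := by
  classical
  set ι : C → Fin n := fun w => ((w : H.verts) : Fin n) with hι
  have hιinj : Function.Injective ι := Subtype.val_injective.comp Subtype.val_injective
  set U : Set (Fin n) := Set.range ι with hU
  have hadj : ∀ (w : C) (j : Fin n), H.Adj (ι w) j →
      ∃ w' : C, ι w' = j ∧ C.toSimpleGraph.Adj w w' := fun w j hwj => by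
    have hcoe : H.coe.Adj (w : H.verts) ⟨j, H.edge_vert hwj.symm⟩ := hwj
    have hmem : (⟨j, H.edge_vert hwj.symm⟩ : H.verts) ∈ C :=
      C.mem_supp_of_adj_mem_supp w.2 hcoe
    exact ⟨⟨_, hmem⟩, rfl, hcoe⟩
  have hcut : ∀ i ∈ U, ∀ j ∉ U, J i j = 0 := by
    rintro _ ⟨w, rfl⟩ j hj
    refine hJH _ _ (fun e => hj ⟨w, e⟩) fun hwj => ?_
    obtain ⟨w', hw', -⟩ := hadj w j hwj
    exact hj ⟨w', hw'⟩
  have hxU : ∀ i ∉ U, x i = 0 := fun i hi => by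
    by_contra hne
    exact hi (hx i hne).2
  rw [linVar_restrict hJ h hcut hxU]
  have hcard : C.toSimpleGraph.edgeSet.ncard ≤ Nat.card C := by
    unfold treeExcess at hC
    omega
  obtain ⟨par, ord, e, hpar, hedge⟩ := exists_parent C.connected_toSimpleGraph hcard
  -- Vertices outside the component become roots; the restricted interaction does not couple them.
  set Par : Fin n → Fin n := Function.extend ι (ι ∘ par) id with hPar
  have hPar_apply : ∀ w, Par (ι w) = ι (par w) := fun w => hιinj.extend_apply _ _ w
  have hPar_iter : ∀ a w, Par^[a] (ι w) = ι (par^[a] w) := fun a w => by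
    induction a generalizing w with
    | zero => rfl
    | succ a ih => rw [Function.iterate_succ_apply, hPar_apply, ih, Function.iterate_succ_apply]
  refine linVar_le_of_unicyclic (par := Par) (ord := Function.extend ι ord 0) (fun u => ?_) ?_ _
    hγ0 hγ1 hD hc (e.map ι) (fun i j hij hne => ?_) (fun i j hij => ?_) (T ∩ U) (fun a w => ?_) x
    (fun i hi => ?_)
  · by_cases hu : ∃ w, ι w = u
    · obtain ⟨w, rfl⟩ := hu
      rw [hPar_apply, hιinj.extend_apply, hιinj.extend_apply]
      rcases hpar w with h | h
      · left; rw [h]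
      · exact Or.inr h.2
    · left
      rw [hPar, Function.extend_apply' _ _ _ hu, id]
  · refine Matrix.IsSymm.ext fun i j => ?_
    simp only [restrict, Matrix.of_apply, hJ.apply i j]
    by_cases hi : i ∈ U <;> by_cases hj : j ∈ U <;> simp [hi, hj]
  · simp only [restrict, Matrix.of_apply, ne_eq, ite_eq_right_iff, not_forall] at hne
    obtain ⟨⟨⟨w, rfl⟩, -⟩, hne⟩ := hne
    have hAdj : H.Adj (ι w) j := by
      by_contra hA
      exact hne (hJH _ _ hij hA)
    obtain ⟨w', rfl, hww'⟩ := hadj w j hAdj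
    rw [hPar_apply, hPar_apply]
    rcases hedge w w' hww' with h | h | h
    · exact Or.inl (congrArg ι h)
    · exact Or.inr (Or.inl (congrArg ι h))
    · right; right; rw [← h, Sym2.map_mk]
  · simp only [restrict, Matrix.of_apply]
    split_ifs
    · exact hb i j hij
    · simp only [abs_zero]; positivity
  · rcases Set.eq_empty_or_nonempty {u ∈ T ∩ U | Par^[a] u = w} with hemp | ⟨u, hu⟩
    · rw [hemp, Set.ncard_empty, Nat.cast_zero]; positivity
    · obtain ⟨⟨-, u, rfl⟩, hw⟩ := hu
      rw [hPar_iter] at hw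
      refine le_trans ?_ (hT a (par^[a] u : C))
      rw [Nat.cast_le]
      refine (Set.ncard_le_ncard (t := (fun v : H.verts => (v : Fin n)) ''
        {v : H.verts | (v : Fin n) ∈ T ∧ H.coe.edist (par^[a] u : C) v ≤ a}) ?_).trans
        (Set.ncard_image_le)
      rintro _ ⟨⟨hT', v, rfl⟩, hv⟩
      refine ⟨v, ⟨hT', ?_⟩, rfl⟩
      rw [hPar_iter, ← hw] at hv
      rw [← hιinj hv]
      exact edist_iterate_le H.coe (fun w : C => (w : H.verts))
        (fun u => (hpar u).imp_right fun h => h.1) a v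
  · by_contra hne
    exact hi (hx i hne)

lemma linVar_eq_sum_of_uncorrelated {κ : Type*} [DecidableEq κ] (J : Matrix (Fin n) (Fin n) ℝ)
    (h : Fin n → ℝ) (col : Fin n → κ) (hcol : ∀ i j, col i ≠ col j → spinCov J h i j = 0)
    (x : Fin n → ℝ) :
    linVar J h x = ∑ c ∈ Finset.univ.image col,
      linVar J h (fun i => if col i = c then x i else 0) := by
  simp only [linVar_eq_sum]
  symm
  rw [Finset.sum_comm]
  refine Finset.sum_congr rfl fun i _ => ?_
  rw [Finset.sum_comm]
  refine Finset.sum_congr rfl fun j _ => ?_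
  rw [Finset.sum_eq_single (col i)]
  · by_cases hij : col i = col j
    · simp [hij]
    · simp [hcol i j hij]
  · intro c _ hc
    simp [Ne.symm hc]
  · simp

lemma one_le_exp_div {γ D : ℝ} (hγ0 : 0 ≤ γ) (hγ1 : γ < 1) :
    1 ≤ Real.exp (2 * γ / √D) / (1 - γ) ^ 2 := by
  rw [one_le_div (pow_pos (by linarith) 2)]
  have h1 : 1 ≤ Real.exp (2 * γ / √D) := Real.one_le_exp (by positivity)
  nlinarith

/-- The variance of a linear statistic under an Ising model on a near-forest. -/
lemma linVar_le_of_nearForest {G : SimpleGraph (Fin n)} (H : G.Subgraph)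
    (hH : IsNearForest H.coe)
    {J : Matrix (Fin n) (Fin n) ℝ} (hJ : J.IsSymm) (hJH : SupportedOn J H) (h : Fin n → ℝ)
    {γ D c : ℝ} (hγ0 : 0 ≤ γ) (hγ1 : γ < 1) (hD : 0 < D) (hc : 0 ≤ c)
    (hb : ∀ i j, i ≠ j → |J i j| ≤ γ / √D) (T : Set (Fin n))
    (hT : ∀ (a : ℕ) (u : H.verts),
      ({v : H.verts | ((v : Fin n) ∈ T ∧ (v : Fin n) ∈ H.support) ∧
        H.coe.edist u v ≤ a}.ncard : ℝ) ≤ c * D ^ a)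
    (hiso : ∀ i ∈ T, i ∉ H.support → 1 ≤ c)
    (x : Fin n → ℝ) (hx : ∀ i ∉ T, x i = 0) :
    linVar J h x ≤ c * (Real.exp (2 * γ / √D) / (1 - γ) ^ 2) * ∑ i, x i ^ 2 := by
  classical
  have hA := one_le_exp_div (D := D) hγ0 hγ1
  set A := Real.exp (2 * γ / √D) / (1 - γ) ^ 2 with hAdef
  -- Vertices incident to no edge of H form singleton classes, including any that belong to
  -- `H.verts`. Distinct classes are uncorrelated, so the variance splits over them.
  set col : Fin n → H.coe.ConnectedComponent ⊕ Fin n := fun i =>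
    if hi : i ∈ H.support then
      Sum.inl (H.coe.connectedComponentMk ⟨i, H.support_subset_verts hi⟩) else Sum.inr i with hcol
  have hcol_adj : ∀ i j, H.Adj i j → col i = col j := fun i j hij => by
    have hi : i ∈ H.support := ⟨j, hij⟩
    have hj : j ∈ H.support := ⟨i, hij.symm⟩
    simp only [hcol, hi, hj, dif_pos]
    congr 1
    exact SimpleGraph.ConnectedComponent.sound (SimpleGraph.Adj.reachable (G := H.coe) hij)
  have hunc : ∀ i j, col i ≠ col j → spinCov J h i j = 0 := fun i j hij => by
    refine spinCov_eq_zero_of_cut (U := {k | col k = col i}) hJ h (fun a ha b hb => ?_) rfl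
      (Ne.symm hij)
    refine hJH a b (fun e => hb (e ▸ ha)) fun hab => hb ?_
    exact (hcol_adj a b hab).symm.trans ha
  rw [linVar_eq_sum_of_uncorrelated J h col hunc x]
  have hsum : ∑ i, x i ^ 2 = ∑ k ∈ Finset.univ.image col,
      ∑ i, (if col i = k then x i else 0) ^ 2 := by
    rw [Finset.sum_comm]
    refine Finset.sum_congr rfl fun i _ => ?_
    rw [Finset.sum_eq_single (col i)]
    · simp
    · intro c _ hc; simp [Ne.symm hc]
    · simp
  rw [hsum, Finset.mul_sum]
  refine Finset.sum_le_sum fun k _ => ?_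
  rcases k with C | k
  · refine linVar_le_of_component H C (hH C) hJ hJH h hγ0 hγ1 hD hc hb (T ∩ H.support) hT _
      fun i hi => ?_
    have hi1 : col i = Sum.inl C := by
      by_contra hne; simp [hne] at hi
    have hi2 : x i ≠ 0 := by simpa [hi1] using hi
    have hiH : i ∈ H.support := by
      by_contra hne; simp [hcol, hne] at hi1
    refine ⟨⟨by_contra fun hne => hi2 (hx i hne), hiH⟩, ?_⟩
    simp only [hcol, hiH, dif_pos, Sum.inl.injEq] at hi1
    exact ⟨⟨⟨i, H.support_subset_verts hiH⟩, hi1⟩, rfl⟩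
  · have hk : ∀ i, (if col i = Sum.inr k then x i else 0) ≠ 0 →
        i = k ∧ i ∉ H.support ∧ x i ≠ 0 := fun i hi => by
      have hi1 : col i = Sum.inr k := by
        by_contra hne; simp [hne] at hi
      have hi2 : x i ≠ 0 := by simpa [hi1] using hi
      have hiH : i ∉ H.support := by
        intro hm; simp [hcol, hm] at hi1
      simp only [hcol, hiH, dif_neg, not_false_eq_true, Sum.inr.injEq] at hi1
      exact ⟨hi1, hiH, hi2⟩
    set y : Fin n → ℝ := fun i => if col i = Sum.inr k then x i else 0 with hy
    have hy0 : ∀ i, i ≠ k → y i = 0 := fun i hi => by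
      by_contra hne
      exact hi (hk i hne).1
    have hvar : linVar J h y = y k * y k * spinCov J h k k := by
      rw [linVar_eq_sum, Finset.sum_eq_single k, Finset.sum_eq_single k]
      · intro j _ hj; simp [hy0 j hj]
      · simp
      · intro j _ hj; simp [hy0 j hj]
      · simp
    have hsq : ∑ i, y i ^ 2 = y k ^ 2 := by
      rw [Finset.sum_eq_single k]
      · intro j _ hj; simp [hy0 j hj]
      · simp
    rw [hvar]
    simp only [hy] at hsq
    rw [hsq]
    by_cases hyk : y k = 0
    · simp only [hy] at hyk; simp [hyk, hy]
    · obtain ⟨-, hkH, hxk⟩ := hk k hyk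
      have hc1 : 1 ≤ c := hiso k (by_contra fun hne => hxk (hx k hne)) hkH
      have h1 := spinCov_self_le_one J h k
      change y k * y k * spinCov J h k k ≤ c * A * y k ^ 2
      -- For a singleton class the variance of a spin is at most 1; this is where 1 ≤ c is needed.
      have h2 : 1 ≤ c * A := one_le_mul_of_one_le_of_one_le hc1 hA
      nlinarith [mul_self_nonneg (y k)]

/-! ### The covariance bound for a bulk and a near-forest -/

/-- Every ball contains its centre, so DᵏΔ ≥ 1 for all k, which rules out D < 1. -/
lemma one_le_of_isPseudorandom {W : Type*} [Finite W] {F : SimpleGraph W} {S : Set W} {Δ D : ℝ}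
    (hF : IsPseudorandom F S Δ D) (u : W) : 1 ≤ Δ ∧ 1 ≤ D := by
  have h : ∀ k : ℕ, 1 ≤ D ^ k * Δ := fun k => by
    refine le_trans ?_ (hF.ball_le (k + 1) (by omega) u)
    rw [Nat.one_le_cast, Nat.one_le_iff_ne_zero]
    exact Set.ncard_ne_zero_of_mem (a := u) (by simp)
  have hΔ : 1 ≤ Δ := by simpa using h 0
  refine ⟨hΔ, ?_⟩
  by_contra! hD1
  obtain ⟨k, hk⟩ := exists_pow_lt_of_lt_one (show 0 < 1 / Δ by positivity) hD1
  rw [lt_div_iff₀ (by positivity)] at hk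
  linarith [h k]

lemma ncard_ball_le_of_isPseudorandom {W : Type*} [Finite W] {F : SimpleGraph W} {S : Set W}
    {Δ D : ℝ} (hF : IsPseudorandom F S Δ D) (a : ℕ) (u : W) :
    ({v | F.edist u v ≤ a}.ncard : ℝ) ≤ Δ * D ^ a := by
  obtain ⟨hΔ, hD1⟩ := one_le_of_isPseudorandom hF u
  rcases Nat.eq_zero_or_pos a with rfl | ha
  · have : {v | F.edist u v ≤ (0 : ℕ)} = {u} := by
      ext v
      rw [Set.mem_ofPred_eq, Nat.cast_zero, nonpos_iff_eq_zero, SimpleGraph.edist_eq_zero_iff]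
      exact eq_comm
    simpa [this] using hΔ
  · refine (hF.ball_le a ha u).trans ?_
    rw [mul_comm]
    exact mul_le_mul_of_nonneg_left (pow_le_pow_right₀ hD1 (Nat.sub_le a 1)) (by linarith)

lemma dotProduct_idOn_mulVec (S : Set (Fin n)) (v : Fin n → ℝ) :
    v ⬝ᵥ (idOn S).mulVec v = ∑ i, S.indicator v i ^ 2 := by
  classical
  refine Finset.sum_congr rfl fun i _ => ?_
  rw [idOn, Matrix.mulVec_diagonal]
  by_cases hi : i ∈ S <;> simp [hi, sq]

lemma dotProduct_cov_ising_mulVec (J : Matrix (Fin n) (Fin n) ℝ) (h v : Fin n → ℝ) :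
    v ⬝ᵥ (cov (ising J h)).mulVec v = linVar J h v := by
  simp only [linVar_eq_sum, dotProduct, Matrix.mulVec, cov_ising, Finset.mul_sum]
  exact Finset.sum_congr rfl fun i _ => Finset.sum_congr rfl fun j _ => by ring

lemma dotProduct_sum_vecMulVec_mulVec {m : ℕ} (b : Fin m → Fin n → ℝ) (v : Fin n → ℝ) :
    v ⬝ᵥ (∑ k, Matrix.vecMulVec (b k) (b k)).mulVec v = ∑ k, (b k ⬝ᵥ v) ^ 2 := by
  simp only [Matrix.sum_mulVec, dotProduct_sum]
  refine Finset.sum_congr rfl fun k _ => ?_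
  rw [Matrix.vecMulVec_mulVec, dotProduct_smul, MulOpposite.smul_eq_mul_unop,
    MulOpposite.unop_op, dotProduct_comm v, sq]

/-- The near-forest contribution: a variance bound that is uniform in the external field. -/
lemma linVar_le_of_isDecomposition {G : SimpleGraph (Fin n)} {B H : G.Subgraph} {Δ D : ℝ}
    (hBH : IsDecomposition G B H Δ D) (hD : 0 < D) {J : Matrix (Fin n) (Fin n) ℝ}
    (hJ : J.IsSymm) (hJH : SupportedOn J H) {γ : ℝ} (hγ0 : 0 ≤ γ) (hγ1 : γ < 1)
    (hb : ∀ i j, i ≠ j → |J i j| ≤ γ / √D) {ε : ℝ} (hε : 0 < ε) (h x : Fin n → ℝ) :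
    linVar J h x ≤ Real.exp (2 * γ / √D) / (1 - γ) ^ 2 *
      ((1 + ε) * ∑ i, (H.support \ boundary B H)ᶜ.indicator x i ^ 2 +
        (1 + 1 / ε) * (max Δ 0 * ∑ i, (H.support \ boundary B H).indicator x i ^ 2)) := by
  classical
  -- The complement of T meets V'(H) only in ∂H, where the growth is Dʳ, so c = 1 there. On T the
  -- full balls give c = Δ; the maximum with 0 covers an H without vertices, where Δ is
  -- unconstrained.
  set T := H.support \ boundary B H with hT
  set A := Real.exp (2 * γ / √D) / (1 - γ) ^ 2 with hA
  have hx : x = Tᶜ.indicator x + T.indicator x := (Set.indicator_compl_add_self T x).symm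
  have h1 : linVar J h (Tᶜ.indicator x) ≤ 1 * A * ∑ i, Tᶜ.indicator x i ^ 2 := by
    refine linVar_le_of_nearForest H hBH.near_forest hJ hJH h hγ0 hγ1 hD zero_le_one hb Tᶜ
      (fun a u => ?_) (fun _ _ _ => le_rfl) _ (fun i hi => Set.indicator_of_notMem hi _)
    rw [one_mul]
    refine le_trans ?_ (hBH.pseudorandom.ball_inter_le a u)
    rw [Nat.cast_le]
    refine Set.ncard_le_ncard ?_ (Set.toFinite _)
    rintro v ⟨⟨hv, hvH⟩, hd⟩
    exact ⟨by_contra fun hvb => hv ⟨hvH, hvb⟩, hd⟩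
  have h2 : linVar J h (T.indicator x) ≤ max Δ 0 * A * ∑ i, T.indicator x i ^ 2 := by
    refine linVar_le_of_nearForest H hBH.near_forest hJ hJH h hγ0 hγ1 hD (le_max_right _ _) hb T
      (fun a u => ?_) (fun i hi hi' => absurd hi.1 hi') _
      (fun i hi => Set.indicator_of_notMem hi _)
    refine le_trans ?_ ((ncard_ball_le_of_isPseudorandom hBH.pseudorandom a u).trans
      (mul_le_mul_of_nonneg_right (le_max_left _ _) (pow_nonneg hD.le a)))
    rw [Nat.cast_le]
    exact Set.ncard_le_ncard (fun v hv => hv.2) (Set.toFinite _)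
  calc linVar J h x = linVar J h (Tᶜ.indicator x + T.indicator x) := by rw [← hx]
    _ ≤ _ := linVar_add_le J h _ _ hε
    _ ≤ (1 + ε) * (1 * A * ∑ i, Tᶜ.indicator x i ^ 2) +
        (1 + 1 / ε) * (max Δ 0 * A * ∑ i, T.indicator x i ^ 2) := by gcongr
    _ = _ := by ring

/-- A bound on `JB` is inherited by the vectors of a rank-one decomposition. -/
lemma sum_sq_le_of_sum_dotProduct_sq_le {m : ℕ} {b : Fin m → Fin n → ℝ} {K : ℝ} {S : Set (Fin n)}
    (hK : 0 ≤ K) (hb : ∀ v, ∑ k, (b k ⬝ᵥ v) ^ 2 ≤ K * ∑ i, S.indicator v i ^ 2) (c : Fin m → ℝ) :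
    ∑ i, (∑ k, c k • b k) i ^ 2 ≤ K * ∑ k, c k ^ 2 := by
  set y := ∑ k, c k • b k with hy
  have h1 : ∑ i, y i ^ 2 = ∑ k, c k * (b k ⬝ᵥ y) := by
    calc ∑ i, y i ^ 2 = y ⬝ᵥ y := Finset.sum_congr rfl fun i _ => sq _
      _ = (∑ k, c k • b k) ⬝ᵥ y := by rw [← hy]
      _ = _ := by simp only [sum_dotProduct, smul_dotProduct, smul_eq_mul]
  -- Duality between c ↦ Σ c_k b_k and its transpose: Cauchy–Schwarz on |y|² = Σ c_k⟨b_k, y⟩, after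
  -- which one factor |y|² cancels.
  have h2 : (∑ i, y i ^ 2) ^ 2 ≤ (∑ k, c k ^ 2) * (K * ∑ i, y i ^ 2) := by
    calc (∑ i, y i ^ 2) ^ 2 ≤ (∑ k, c k ^ 2) * ∑ k, (b k ⬝ᵥ y) ^ 2 := by
          rw [h1]; exact Finset.sum_mul_sq_le_sq_mul_sq _ _ _
      _ ≤ _ := by
          refine mul_le_mul_of_nonneg_left ((hb y).trans ?_)
            (Finset.sum_nonneg fun _ _ => sq_nonneg _)
          refine mul_le_mul_of_nonneg_left (Finset.sum_le_sum fun i _ => ?_) hK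
          by_cases hi : i ∈ S <;> simp [hi, sq_nonneg]
  rcases (Finset.sum_nonneg fun i _ => sq_nonneg (y i) :
    0 ≤ ∑ i, y i ^ 2).eq_or_lt with h0 | hpos
  · rw [← h0]
    exact mul_nonneg hK (Finset.sum_nonneg fun _ _ => sq_nonneg _)
  · refine le_of_mul_le_mul_right ?_ hpos
    calc _ = (∑ i, y i ^ 2) ^ 2 := by ring
      _ ≤ _ := h2
      _ = _ := by ring

lemma add_sq_le_of_pos {ε : ℝ} (hε : 0 < ε) (a b : ℝ) :
    (a + b) ^ 2 ≤ (1 + 1 / ε) * a ^ 2 + (1 + ε) * b ^ 2 := by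
  have h : (1 + 1 / ε) * a ^ 2 + (1 + ε) * b ^ 2 - (a + b) ^ 2 = 1 / ε * (a - ε * b) ^ 2 := by
    field_simp; ring
  have : 0 ≤ 1 / ε * (a - ε * b) ^ 2 := by positivity
  linarith

lemma sum_indicator_add_sq_le {ε : ℝ} (hε : 0 < ε) (S : Set (Fin n)) (v y : Fin n → ℝ) :
    ∑ i, S.indicator (v + y) i ^ 2 ≤
      (1 + 1 / ε) * ∑ i, S.indicator v i ^ 2 + (1 + ε) * ∑ i, y i ^ 2 := by
  rw [Finset.mul_sum, Finset.mul_sum, ← Finset.sum_add_distrib]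
  refine Finset.sum_le_sum fun i _ => ?_
  by_cases hi : i ∈ S
  · simpa [hi] using add_sq_le_of_pos hε (v i) (y i)
  · simp only [Set.indicator_of_notMem hi, ne_eq, OfNat.ofNat_ne_zero, not_false_eq_true,
      zero_pow, mul_zero, zero_add]
    positivity

/-- The near-forest bound is evaluated at v + y with y = Σ c_k b_k. Separating Tᶜ from T and then v
from y each cost 1 + ε, so the shift contributes at most (1+ε)²KA Σ c_k², which `hgap` absorbs. -/
lemma linVar_add_le_of_isDecomposition {G : SimpleGraph (Fin n)} {B H : G.Subgraph} {Δ D : ℝ}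
    (hBH : IsDecomposition G B H Δ D) (hD : 0 < D) {JB JH : Matrix (Fin n) (Fin n) ℝ}
    (hJH : JH.IsSymm) (hJHs : SupportedOn JH H) {γ K ε : ℝ} (hγ0 : 0 ≤ γ) (hγ1 : γ < 1)
    (hb : ∀ i j, i ≠ j → |JH i j| ≤ γ / √D) (hK : 0 < K) (hε : 0 < ε)
    (hJB : JB.PosSemidef)
    (hJBK : ∀ v, v ⬝ᵥ JB.mulVec v ≤ K * ∑ i, B.support.indicator v i ^ 2)
    (hgap : (1 + ε) ^ 2 * (K * (Real.exp (2 * γ / √D) / (1 - γ) ^ 2)) ≤ 1) (h v : Fin n → ℝ) :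
    linVar (JB + JH) h v ≤ Real.exp (2 * γ / √D) / (1 - γ) ^ 2 * ((1 + ε) * (1 + 1 / ε)) *
      (∑ i, (H.support \ boundary B H)ᶜ.indicator v i ^ 2 +
        max Δ 0 * ∑ i, (H.support \ boundary B H).indicator v i ^ 2) := by
  classical
  obtain ⟨m, b, hJb⟩ := Matrix.posSemidef_iff_eq_sum_vecMulVec.1 hJB
  simp only [star_trivial] at hJb
  subst hJb
  simp only [dotProduct_sum_vecMulVec_mulVec] at hJBK
  set T := H.support \ boundary B H with hT
  have hA1 := one_le_exp_div (D := D) hγ0 hγ1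
  set A := Real.exp (2 * γ / √D) / (1 - γ) ^ 2 with hA
  rw [add_comm]
  refine linVar_add_sum_vecMulVec_le JH _
    (fun h x => linVar_le_of_isDecomposition hBH hD hJH hJHs hγ0 hγ1 hb hε h x) b Finset.univ v _
    (fun c => ?_) h
  set y := ∑ k, c k • b k with hy
  have hyc : ∑ i, y i ^ 2 ≤ K * ∑ k, c k ^ 2 := sum_sq_le_of_sum_dotProduct_sq_le hK.le hJBK c
  -- Testing the quadratic bound on the i-th basis vector gives zero. Hence y vanishes on T and is
  -- never multiplied by Δ.
  have hbB : ∀ i ∉ B.support, ∀ k, b k i = 0 := fun i hi k => by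
    have h1 := hJBK (Pi.single i 1)
    have h2 : ∀ j, B.support.indicator (Pi.single i (1 : ℝ)) j ^ 2 = 0 := fun j => by
      by_cases hj : j ∈ B.support
      · have : j ≠ i := fun e => hi (e ▸ hj)
        simp [hj, this]
      · simp [hj]
    simp only [h2, Finset.sum_const_zero, mul_zero, dotProduct_single, mul_one] at h1
    have h3 := Finset.single_le_sum (f := fun k => b k i ^ 2) (fun k _ => sq_nonneg _)
      (Finset.mem_univ k)
    exact pow_eq_zero_iff two_ne_zero |>.1 (le_antisymm (h3.trans h1) (sq_nonneg _))
  have hyT : ∀ i ∈ T, y i = 0 := fun i hi => by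
    have hiB : i ∉ B.support := fun hB => hi.2 ⟨hB, hi.1⟩
    simp [hy, Finset.sum_apply, hbB i hiB]
  have e2 : T.indicator (v + y) = T.indicator v := by
    ext i
    by_cases hi : i ∈ T <;> simp [hi, hyT]
  have e1 := sum_indicator_add_sq_le hε Tᶜ v y
  rw [e2]
  have hN1 : 0 ≤ ∑ i, Tᶜ.indicator v i ^ 2 := Finset.sum_nonneg fun _ _ => sq_nonneg _
  have hN2 : 0 ≤ max Δ 0 * ∑ i, T.indicator v i ^ 2 :=
    mul_nonneg (le_max_right _ _) (Finset.sum_nonneg fun _ _ => sq_nonneg _)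
  have hc0 : 0 ≤ ∑ k, c k ^ 2 := Finset.sum_nonneg fun _ _ => sq_nonneg _
  have hA0 : 0 ≤ A := by linarith
  have hε1 : 0 < 1 / ε := by positivity
  calc A * ((1 + ε) * ∑ i, Tᶜ.indicator (v + y) i ^ 2 +
        (1 + 1 / ε) * (max Δ 0 * ∑ i, T.indicator v i ^ 2))
      ≤ A * ((1 + ε) * ((1 + 1 / ε) * ∑ i, Tᶜ.indicator v i ^ 2 +
          (1 + ε) * (K * ∑ k, c k ^ 2)) +
        (1 + ε) * (1 + 1 / ε) * (max Δ 0 * ∑ i, T.indicator v i ^ 2)) := by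
        gcongr A * (?_ + ?_)
        · exact mul_le_mul_of_nonneg_left (e1.trans (by gcongr)) (by positivity)
        · refine mul_le_mul_of_nonneg_right ?_ hN2
          exact le_mul_of_one_le_left (by positivity) (by linarith)
    _ = A * ((1 + ε) * (1 + 1 / ε)) * (∑ i, Tᶜ.indicator v i ^ 2 +
          max Δ 0 * ∑ i, T.indicator v i ^ 2) +
        ((1 + ε) ^ 2 * (K * A)) * ∑ k, c k ^ 2 := by ring
    _ ≤ _ := by
        gcongr
        exact mul_le_of_le_one_left hc0 hgap

end NearForestIsing

/-! ### Assembly of the covariance bound -/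

theorem theorem3p4 (η K γ δ : ℝ) (hη : η ∈ Set.Ioo (0 : ℝ) 1) (hK : K ∈ Set.Ioo (0 : ℝ) 1)
    (hγ : γ ∈ Set.Ico (0 : ℝ) 1) (hδ : 0 < δ) :
    ∃ C : ℝ, 0 < C ∧
      ∀ (n : ℕ) (Δ D : ℝ) (G : SimpleGraph (Fin n)) (B H : G.Subgraph)
        (JB JH : Matrix (Fin n) (Fin n) ℝ),
        0 < D →
        NearForestIsing.IsDecomposition G B H Δ D →
        JB.IsSymm → JH.IsSymm →
        NearForestIsing.SupportedOn JB B → NearForestIsing.SupportedOn JH H →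
        NearForestIsing.Loewner (η • NearForestIsing.idOn B.support) JB →
        NearForestIsing.Loewner JB (K • NearForestIsing.idOn B.support) →
        (∀ i j, i ≠ j → JH i j ∈ Set.Icc (-(γ / √D)) (γ / √D)) →
        K * (Real.exp (2 * γ / √D) / (1 - γ) ^ 2) ≤ 1 - δ →
        ∀ t ∈ Set.Icc (0 : ℝ) 1, ∀ h : Fin n → ℝ,
          NearForestIsing.Loewner
            (NearForestIsing.cov (NearForestIsing.ising ((1 - t) • JB + JH) h))
            (C • (NearForestIsing.idOn B.support
              + Δ • NearForestIsing.idOn (H.support \ NearForestIsing.boundary B H)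
              + NearForestIsing.idOn G.supportᶜ)) := by
  classical
  open NearForestIsing in
  have hε : 0 < δ / 4 := by linarith
  have hε1 : 0 < 1 / (δ / 4) := by positivity
  -- The constant is A(1+ε)(1+1/ε) with ε = δ/4 and A replaced by 1/K, which the gap condition
  -- permits.
  refine ⟨1 / K * ((1 + δ / 4) * (1 + 1 / (δ / 4))), mul_pos (one_div_pos.2 hK.1) (by positivity),
    fun n Δ D G B H JB JH hD hBH _ hJHs _ hJHH hηJ hJK hb hgap t ht h => ?_⟩
  have hA1 := one_le_exp_div (D := D) hγ.1 hγ.2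
  have hKA := mul_pos hK.1 (zero_lt_one.trans_le hA1)
  have hAK : Real.exp (2 * γ / √D) / (1 - γ) ^ 2 ≤ 1 / K := by
    rw [le_div_iff₀ hK.1, mul_comm]; linarith
  have hJB : JB.PosSemidef := by
    have h1 : (η • idOn B.support).PosSemidef := by
      refine Matrix.PosSemidef.smul (Matrix.PosSemidef.diagonal fun i => ?_) hη.1.le
      exact Set.indicator_nonneg (fun _ _ => zero_le_one) i
    simpa using Matrix.PosSemidef.add hηJ h1
  have ht0 : 0 ≤ 1 - t := sub_nonneg.2 ht.2
  have hquad : ∀ v, v ⬝ᵥ ((1 - t) • JB).mulVec v ≤ K * ∑ i, B.support.indicator v i ^ 2 := by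
    intro v
    have h1 := hJK.dotProduct_mulVec_nonneg v
    have h2 := hJB.dotProduct_mulVec_nonneg v
    simp only [star_trivial, Matrix.sub_mulVec, dotProduct_sub, Matrix.smul_mulVec,
      dotProduct_smul, dotProduct_idOn_mulVec, smul_eq_mul] at h1 h2 ⊢
    nlinarith [ht.1]
  -- Positivity of KA forces δ < 1, and then (1 + δ/4)²(1 - δ) ≤ 1.
  have hgap' : (1 + δ / 4) ^ 2 * (K * (Real.exp (2 * γ / √D) / (1 - γ) ^ 2)) ≤ 1 := by
    refine (mul_le_mul_of_nonneg_left hgap (sq_nonneg _)).trans ?_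
    have : δ < 1 := by linarith
    nlinarith [sq_nonneg δ, mul_pos hδ hδ, mul_pos (mul_pos hδ hδ) hδ]
  have hbound := linVar_add_le_of_isDecomposition hBH hD hJHs hJHH hγ.1 hγ.2
    (fun i j hij => abs_le.2 (hb i j hij)) hK.1 hε (hJB.smul ht0) hquad hgap' h
  refine Matrix.PosSemidef.of_dotProduct_mulVec_nonneg ?_ fun v => ?_
  · refine Matrix.IsHermitian.ext fun i j => ?_
    simp only [Matrix.sub_apply, Matrix.smul_apply, Matrix.add_apply, star_trivial, cov_ising,
      spinCov_comm _ h j i, idOn, Matrix.diagonal_apply, smul_eq_mul]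
    by_cases hij : i = j
    · subst hij; rfl
    · simp [hij, Ne.symm hij]
  · simp only [star_trivial, Matrix.sub_mulVec, dotProduct_sub, Matrix.smul_mulVec,
      Matrix.add_mulVec, dotProduct_add, dotProduct_smul, dotProduct_idOn_mulVec,
      dotProduct_cov_ising_mulVec, smul_eq_mul, sub_nonneg]
    -- Every vertex outside V'(H)∖∂H lies in V'(B) or is isolated in G.
    have hN1 : ∑ i, (H.support \ boundary B H)ᶜ.indicator v i ^ 2 ≤
        ∑ i, B.support.indicator v i ^ 2 + ∑ i, G.supportᶜ.indicator v i ^ 2 := by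
      rw [← Finset.sum_add_distrib]
      refine Finset.sum_le_sum fun i _ => ?_
      by_cases hB : i ∈ B.support
      · simp only [Set.indicator_of_mem hB]
        have : (H.support \ boundary B H)ᶜ.indicator v i ^ 2 ≤ v i ^ 2 := by
          by_cases hi : i ∈ (H.support \ boundary B H)ᶜ
          · rw [Set.indicator_of_mem hi]
          · rw [Set.indicator_of_notMem hi, zero_pow two_ne_zero]; exact sq_nonneg _
        nlinarith [sq_nonneg (G.supportᶜ.indicator v i)]
      by_cases hG : i ∈ G.support
      · obtain ⟨j, hij⟩ := hG
        have hi : i ∈ H.support \ boundary B H := by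
          refine ⟨⟨j, ?_⟩, fun hbd => hB hbd.1⟩
          have he : s(i, j) ∈ B.edgeSet ∪ H.edgeSet := hBH.edges_union ▸ hij
          exact he.resolve_left fun hBe => hB ⟨j, hBe⟩
        rw [Set.indicator_of_notMem (not_not.2 hi), zero_pow two_ne_zero]
        positivity
      · have hi : i ∈ (H.support \ boundary B H)ᶜ := fun hc => by
          obtain ⟨j, hj⟩ := hc.1
          exact hG ⟨j, hj.adj_sub⟩
        rw [Set.indicator_of_mem hi, Set.indicator_of_mem (show i ∈ G.supportᶜ from hG)]
        nlinarith [sq_nonneg (B.support.indicator v i)]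
    -- Either the set is empty and both sides vanish, or H has a vertex and Δ ≥ 1.
    have hN2 : max Δ 0 * ∑ i, (H.support \ boundary B H).indicator v i ^ 2 =
        Δ * ∑ i, (H.support \ boundary B H).indicator v i ^ 2 := by
      rcases (H.support \ boundary B H).eq_empty_or_nonempty with h0 | ⟨i, hi⟩
      · simp [h0]
      · have := (one_le_of_isPseudorandom hBH.pseudorandom
          ⟨i, H.support_subset_verts hi.1⟩).1
        rw [max_eq_left (by linarith)]
    refine (hbound v).trans ?_
    have hpos : 0 ≤ max Δ 0 * ∑ i, (H.support \ boundary B H).indicator v i ^ 2 :=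
      mul_nonneg (le_max_right _ _) (Finset.sum_nonneg fun _ _ => sq_nonneg _)
    calc _ ≤ 1 / K * ((1 + δ / 4) * (1 + 1 / (δ / 4))) *
          (∑ i, (H.support \ boundary B H)ᶜ.indicator v i ^ 2 +
            max Δ 0 * ∑ i, (H.support \ boundary B H).indicator v i ^ 2) := by
          have : 0 ≤ ∑ i, (H.support \ boundary B H)ᶜ.indicator v i ^ 2 :=
            Finset.sum_nonneg fun _ _ => sq_nonneg _
          gcongr
      _ ≤ 1 / K * ((1 + δ / 4) * (1 + 1 / (δ / 4))) *
          (∑ i, B.support.indicator v i ^ 2 + ∑ i, G.supportᶜ.indicator v i ^ 2 +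
            max Δ 0 * ∑ i, (H.support \ boundary B H).indicator v i ^ 2) := by
          have : 0 ≤ 1 / K := one_div_nonneg.2 hK.1.le
          gcongr
      _ = _ := by rw [hN2]; ring
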